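/- Let $n,k\ge 0$ be integers. \emph{Operads.} Operads are symmetric topological operads in $k$-spaces, with operations of all arities $\ge 0$. Let $\mathcal{A}ss$ be the operad of monoid structures and $\mathcal{C}_n$ the little $n$-cubes operad; $\mathcal{C}_n(1)$ is the space of pairs $(x,y)$ of points of $[0,1]^n$ with $x_i<y_i$ for all $i$ (the lowest and the highest corner of a cube). $\mathcal{A}ss\otimes\mathcal{C}_n$ is the tensor product of operads, i.e. the quotient of the sum of $\mathcal{A}ss$ and $\mathcal{C}_n$ in the category of operads by the interchange relation; it exists. \emph{Graphs.} Let $\widehat{\mathcal{K}}_n(k)$ be the poset of complete graphs on $\{1,\dots,k\}$ in which every edge is either blank or is oriented and coloured by an element of $\{1,\dots,n\}$, such that no colour has a directed cycle. Here $\lambda_1\le\lambda_2$ iff every blank edge of $\lambda_1$ is blank in $\lambda_2$, and every edge $a\stackrel{i}{\to}b$ of $\lambda_1$ is in $\lambda_2$ blank, or $a\stackrel{j}{\to}b$ with $j\ge i$, or $b\stackrel{j}{\to}a$ with $j>i$. Let $\mathcal{K}_n(k)\subset\widehat{\mathcal{K}}_n(k)$ be the subposet of graphs without blank edges. For $\lambda\in\widehat{\mathcal{K}}_1(k)$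 let $T_k(\lambda)\subset\widehat{\mathcal{K}}_n(k)$ be the subposet of the graphs complementary to $\lambda$, i.e. those obtained from some $\overline\lambda\in\mathcal{K}_{n+1}(k)$, in which the edges coloured in $\lambda$ are oriented as in $\lambda$ and have colour $n+1$, by making these edges blank. For $\lambda_2\le\lambda_1$ there is a map of posets $T_k(\lambda_1)\to T_k(\lambda_2)$ which makes blank all edges that are coloured in $\lambda_2$; so $T_k$ is a functor from $\widehat{\mathcal{K}}_1(k)^{op}$ to posets, with Grothendieck construction $\widehat{\mathcal{K}}_1(k)^{op}\int T_k$. \emph{Spaces.} For $c,d\in\mathcal{C}_n(1)$ write $c<_i d$ if the $i$-th coordinate of the highest corner of $c$ is at most that of the lowest corner of $d$. For $\lambda\in\widehat{\mathcal{K}}_1(k)$ let $A(\lambda)\subset\mathcal{C}_n(1)^k$ be the subspace of all $(c_1,\dots,c_k)$ such that $c_p$ and $c_q$ have disjoint interiors whenever the edge $pq$ is blank in $\lambda$. For $\mu\in\widehat{\mathcal{K}}_n(k)$ let $H(\mu)\subset\mathcal{C}_n(1)^k$ be the subspace of all $(c_1,\dots,c_k)$ with $c_p<_i c_q$ whenever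 $p\stackrel{i}{\to}q$ in $\mu$, and for $\lambda'\in T_k(\lambda)$ let $F_k(\lambda)(\lambda')=\bigcup\{H(\mu):\mu\in T_k(\lambda),\ \mu\le\lambda'\}$. With inclusions as structure maps these define functors $A:\widehat{\mathcal{K}}_1(k)^{op}\to\mathcal{T}op$, $F_k(\lambda):T_k(\lambda)\to\mathcal{T}op$ and $F_k:\widehat{\mathcal{K}}_1(k)^{op}\int T_k\to\mathcal{T}op$, $(\lambda,\lambda')\mapsto F_k(\lambda)(\lambda')$. \emph{Claim.} (1) $(\mathcal{A}ss\otimes\mathcal{C}_n)(k)=\operatorname{colim}A$, where $A(\lambda)\to(\mathcal{A}ss\otimes\mathcal{C}_n)(k)$ sends $(c_1,\dots,c_k)$ to the operation $(x_1,\dots,x_k)\mapsto c_{\sigma 1}(x_{\sigma 1})\cdots c_{\sigma k}(x_{\sigma k})$ for any total order $\sigma 1<\dots<\sigma k$ of the vertices that extends the orientation of $\lambda$. (2) $(\mathcal{A}ss\otimes\mathcal{C}_n)(k)=\operatorname{colim}F_k$, with structure maps given by the same formula. (3) The spaces $H(\mu)$ and $F_k(\lambda)(\lambda')$ are closed in $\mathcal{C}_n(1)^k$.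 (4) For every $\lambda\in\widehat{\mathcal{K}}_1(k)$, $A(\lambda)=\operatorname{colim}F_k(\lambda)$ via the inclusions; and for every $\alpha\in T_k(\lambda)$ the canonical map to $A(\lambda)$ from the colimit of the restriction of $F_k(\lambda)$ to $\{\beta\in T_k(\lambda):\beta<\alpha\}$ is a homeomorphism onto a subspace. (5) There is an isomorphism of categories $\varphi:\mathcal{K}_{n+1}(k)\to\widehat{\mathcal{K}}_1(k)^{op}\int T_k$, $\varphi(\lambda)=(\varphi_1(\lambda),\varphi_2(\lambda))$, where $\varphi_1(\lambda)$ is obtained from $\lambda$ by making all edges of colours $\le n$ blank and replacing the colour $n+1$ by $1$, and $\varphi_2(\lambda)$ by making all edges of colour $n+1$ blank. -/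

import Mathlib

open CategoryTheory

/-! ## Topological operads -/

/-- The equivalence `(Σ _ : Unit, I) ≃ I`. -/
def leftUnitEquiv (I : Type) : (Σ _ : Unit, I) ≃ I :=
  (Equiv.sigmaEquivProd Unit I).trans (Equiv.punitProd I)

/-- The equivalence exchanging the two indices of a constant family. -/
def swapEquiv (I J : Type) : (Σ _ : I, J) ≃ (Σ _ : J, I) :=
  ((Equiv.sigmaEquivProd I J).trans (Equiv.prodComm I J)).trans (Equiv.sigmaEquivProd J I).symm

/-- A symmetric operad (with operations of every finite arity, including arity zero) in the
category of `k`-spaces, in the form where the inputs of an operation are labelled by the elements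
of a finite set `I`; the space of `k`-ary operations is `Op (Fin k)`, and the symmetric group acts
on it by `relabel`. Mathlib's `CompactlyGeneratedSpace` says that the topology is determined by
continuous maps from compact Hausdorff spaces, i.e. that the space is a `k`-space. The product of
`k`-spaces is the `k`-ification of the product topology, and `continuous_comp` says exactly that
composition is continuous for the `k`-space product. -/
structure TopOperad where
  /-- The space of operations whose inputs are labelled by `I`. -/
  Op : (I : Type) → [Finite I] → Type
  [top : ∀ (I : Type) [Finite I], TopologicalSpace (Op I)]
  [kspace : ∀ (I : Type) [Finite I], CompactlyGeneratedSpace (Op I)]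
  /-- Renaming the inputs. -/
  relabel : {I J : Type} → [Finite I] → [Finite J] → (I ≃ J) → Op I → Op J
  /-- The identity operation. -/
  one : Op Unit
  /-- Operadic composition: the output of the `j`-th inner operation is the input `j` of the outer
  operation. -/
  comp : {J : Type} → [Finite J] → {I : J → Type} → [∀ j, Finite (I j)] →
    Op J → (∀ j, Op (I j)) → Op (Σ j, I j)
  relabel_refl : ∀ {I : Type} [Finite I] (p : Op I), relabel (Equiv.refl I) p = p
  relabel_trans : ∀ {I J L : Type} [Finite I] [Finite J] [Finite L] (e : I ≃ J) (f : J ≃ L)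
    (p : Op I), relabel (e.trans f) p = relabel f (relabel e p)
  comp_relabel_right : ∀ {J : Type} [Finite J] {I I' : J → Type} [∀ j, Finite (I j)]
    [∀ j, Finite (I' j)] (e : ∀ j, I j ≃ I' j) (p : Op J) (q : ∀ j, Op (I j)),
    comp p (fun j => relabel (e j) (q j)) = relabel (Equiv.sigmaCongrRight e) (comp p q)
  comp_relabel_left : ∀ {J J' : Type} [Finite J] [Finite J'] {I : J' → Type}
    [∀ j, Finite (I j)] (e : J ≃ J') (p : Op J) (q : ∀ j, Op (I j)),
    comp (relabel e p) q =
      relabel (Equiv.sigmaCongrLeft (β := I) e) (comp p (fun j => q (e j)))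
  one_comp : ∀ {I : Type} [Finite I] (p : Op I),
    relabel (leftUnitEquiv I) (comp one (fun _ => p)) = p
  comp_one : ∀ {I : Type} [Finite I] (p : Op I),
    relabel (Equiv.sigmaPUnit I) (comp p (fun _ => one)) = p
  comp_assoc : ∀ {J : Type} [Finite J] {I : J → Type} [∀ j, Finite (I j)]
    {L : ∀ j, I j → Type} [∀ j i, Finite (L j i)]
    (p : Op J) (q : ∀ j, Op (I j)) (r : ∀ j i, Op (L j i)),
    relabel (Equiv.sigmaAssoc L) (comp (comp p q) (fun x : Σ j, I j => r x.1 x.2)) =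
      comp p (fun j => comp (q j) (r j))
  continuous_relabel : ∀ {I J : Type} [Finite I] [Finite J] (e : I ≃ J),
    Continuous (relabel e : Op I → Op J)
  continuous_comp : ∀ {J : Type} [Finite J] {I : J → Type} [∀ j, Finite (I j)]
    {K : Type} [TopologicalSpace K] [CompactSpace K] [T2Space K]
    (p : K → Op J) (q : ∀ j, K → Op (I j)), Continuous p → (∀ j, Continuous (q j)) →
    Continuous (fun x => comp (p x) (fun j => q j x))

namespace TopOperad

attribute [instance] TopOperad.top TopOperad.kspace

/-- Maps of operads. -/
structure Hom (A B : TopOperad) where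
  /-- The map on spaces of operations. -/
  toFun : {I : Type} → [Finite I] → A.Op I → B.Op I
  continuous_toFun : ∀ (I : Type) [Finite I], Continuous (toFun : A.Op I → B.Op I)
  map_relabel : ∀ {I J : Type} [Finite I] [Finite J] (e : I ≃ J) (p : A.Op I),
    toFun (A.relabel e p) = B.relabel e (toFun p)
  map_one : toFun A.one = B.one
  map_comp : ∀ {J : Type} [Finite J] {I : J → Type} [∀ j, Finite (I j)]
    (p : A.Op J) (q : ∀ j, A.Op (I j)),
    toFun (A.comp p q) = B.comp (toFun p) (fun j => toFun (q j))

/-- Composition of maps of operads. -/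
def Hom.comp {A B D : TopOperad} (g : Hom B D) (f : Hom A B) : Hom A D where
  toFun p := g.toFun (f.toFun p)
  continuous_toFun I _ := (g.continuous_toFun I).comp (f.continuous_toFun I)
  map_relabel e p := by rw [f.map_relabel, g.map_relabel]
  map_one := by rw [f.map_one, g.map_one]
  map_comp p q := by rw [f.map_comp, g.map_comp]

/-- The interchange relation between the operations of `A` and those of `B` inside `D`:
`a (b, …, b) = b (a, …, a)` up to the transposition of the inputs. -/
def Interchange {A B D : TopOperad} (f : Hom A D) (g : Hom B D) : Prop :=
  ∀ (I J : Type) [Finite I] [Finite J] (a : A.Op I) (b : B.Op J),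
    D.relabel (swapEquiv I J) (D.comp (f.toFun a) (fun _ => g.toFun b)) =
      D.comp (g.toFun b) (fun _ => f.toFun a)

/-- `i : A → P` and `j : B → P` exhibit `P` as the tensor product of the operads `A` and `B`,
i.e. as the quotient of their sum in the category of operads by the interchange relation: the
pair `(i, j)` interchanges and is universal among interchanging pairs. -/
structure IsTensorProduct {A B P : TopOperad} (i : Hom A P) (j : Hom B P) : Prop where
  interchange : Interchange i j
  universal : ∀ (D : TopOperad) (f : Hom A D) (g : Hom B D), Interchange f g →
    ∃! h : Hom P D, h.comp i = f ∧ h.comp j = g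

end TopOperad

/-! ## The operad of monoid structures -/

/-- Strict total orders on `I`. -/
@[ext] structure TotalOrd (I : Type) where
  /-- The order relation. -/
  lt : I → I → Prop
  irrefl : ∀ a, ¬ lt a a
  trans : ∀ a b c, lt a b → lt b c → lt a c
  total : ∀ a b, a ≠ b → lt a b ∨ lt b a

namespace TotalOrd

instance (I : Type) : TopologicalSpace (TotalOrd I) := ⊥

instance (I : Type) : DiscreteTopology (TotalOrd I) := ⟨rfl⟩

/-- Transport along a bijection. -/
def relabel {I J : Type} (e : I ≃ J) (r : TotalOrd I) : TotalOrd J where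
  lt a b := r.lt (e.symm a) (e.symm b)
  irrefl _ := r.irrefl _
  trans _ _ _ := r.trans _ _ _
  total _ _ h := r.total _ _ (fun h' => h (e.symm.injective h'))

/-- The lexicographic order. -/
def lex {J : Type} {I : J → Type} (r : TotalOrd J) (s : ∀ j, TotalOrd (I j)) :
    TotalOrd (Σ j, I j) where
  lt := Sigma.Lex r.lt (fun j => (s j).lt)
  irrefl := by
    rintro ⟨j, a⟩ h
    rcases Sigma.lex_iff.1 h with h | ⟨_, h⟩
    · exact r.irrefl _ h
    · exact (s j).irrefl _ h
  trans := by
    rintro ⟨j, a⟩ ⟨j', b⟩ ⟨j'', c⟩ h h'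
    cases h with
    | left _ _ h1 =>
      cases h' with
      | left _ _ h2 => exact Sigma.Lex.left _ _ (r.trans _ _ _ h1 h2)
      | right _ _ h2 => exact Sigma.Lex.left _ _ h1
    | right _ _ h1 =>
      cases h' with
      | left _ _ h2 => exact Sigma.Lex.left _ _ h2
      | right _ _ h2 => exact Sigma.Lex.right _ _ ((s _).trans _ _ _ h1 h2)
  total := by
    rintro ⟨j, a⟩ ⟨j', b⟩ h
    by_cases hj : j = j'
    · subst hj
      have hab : a ≠ b := fun hab => h (by rw [hab])
      exact ((s j).total a b hab).imp (Sigma.Lex.right _ _) (Sigma.Lex.right _ _)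
    · exact (r.total j j' hj).imp (Sigma.Lex.left _ _) (Sigma.Lex.left _ _)

theorem lex_lt_left {J : Type} {I : J → Type} (r : TotalOrd J) (s : ∀ j, TotalOrd (I j))
    {j j' : J} (h : j ≠ j') (a : I j) (b : I j') :
    (r.lex s).lt ⟨j, a⟩ ⟨j', b⟩ ↔ r.lt j j' := by
  constructor
  · intro h'
    rcases Sigma.lex_iff.1 h' with h' | ⟨h', _⟩
    · exact h'
    · exact absurd h' h
  · exact Sigma.Lex.left _ _

theorem lex_lt_right {J : Type} {I : J → Type} (r : TotalOrd J) (s : ∀ j, TotalOrd (I j))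
    (j : J) (a b : I j) : (r.lex s).lt ⟨j, a⟩ ⟨j, b⟩ ↔ (s j).lt a b := by
  constructor
  · intro h'
    rcases Sigma.lex_iff.1 h' with h' | ⟨_, h'⟩
    · exact absurd h' (r.irrefl _)
    · exact h'
  · exact fun h' => Sigma.Lex.right (s := fun j => (s j).lt) a b h'

theorem relabel_lt {I J : Type} (e : I ≃ J) (r : TotalOrd I) (a b : I) :
    (r.relabel e).lt (e a) (e b) ↔ r.lt a b := by
  simp [relabel]

theorem ext_of_relabel {I J : Type} (e : I ≃ J) {r s : TotalOrd J}
    (h : ∀ a b, r.lt (e a) (e b) ↔ s.lt (e a) (e b)) : r = s := by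
  ext x y
  obtain ⟨a, rfl⟩ := e.surjective x
  obtain ⟨b, rfl⟩ := e.surjective y
  exact h a b

end TotalOrd

/-- The operad `Ass` of monoid structures: the operation given by a total order on `I` multiplies
its inputs in increasing order. -/
def assOperad : TopOperad where
  Op I _ := TotalOrd I
  relabel e r := r.relabel e
  one := ⟨fun _ _ => False, fun _ => id, fun _ _ _ h _ => h, fun _ _ h => (h rfl).elim⟩
  comp r s := r.lex s
  relabel_refl _ := rfl
  relabel_trans _ _ _ := rfl
  comp_relabel_right e p q := by
    refine TotalOrd.ext_of_relabel (Equiv.sigmaCongrRight e) ?_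
    rintro ⟨j, a⟩ ⟨j', b⟩
    rw [TotalOrd.relabel_lt]
    by_cases hj : j = j'
    · subst hj
      simp [TotalOrd.lex_lt_right, TotalOrd.relabel_lt]
    · simp [TotalOrd.lex_lt_left _ _ hj]
  comp_relabel_left {J J' _ _ I _} e p q := by
    refine TotalOrd.ext_of_relabel (Equiv.sigmaCongrLeft (β := I) e) ?_
    rintro ⟨j, a⟩ ⟨j', b⟩
    rw [TotalOrd.relabel_lt]
    by_cases hj : j = j'
    · subst hj
      simp [TotalOrd.lex_lt_right, Equiv.sigmaCongrLeft]
    · have hj' : e j ≠ e j' := fun h => hj (e.injective h)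
      simp [TotalOrd.lex_lt_left _ _ hj, TotalOrd.lex_lt_left _ _ hj', Equiv.sigmaCongrLeft,
        TotalOrd.relabel_lt]
  one_comp {I _} p := by
    refine TotalOrd.ext_of_relabel (leftUnitEquiv I) ?_
    rintro ⟨j, a⟩ ⟨j', b⟩
    rw [TotalOrd.relabel_lt, TotalOrd.lex_lt_right]
    rfl
  comp_one {I _} p := by
    refine TotalOrd.ext_of_relabel (Equiv.sigmaPUnit I) ?_
    rintro ⟨j, a⟩ ⟨j', b⟩
    rw [TotalOrd.relabel_lt]
    by_cases hj : j = j'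
    · subst hj
      simp [TotalOrd.lex_lt_right, TotalOrd.irrefl]
    · simp [TotalOrd.lex_lt_left _ _ hj]
  comp_assoc {J _ I _ L _} p q r := by
    refine TotalOrd.ext_of_relabel (Equiv.sigmaAssoc L) ?_
    rintro ⟨⟨j, i⟩, a⟩ ⟨⟨j', i'⟩, b⟩
    rw [TotalOrd.relabel_lt]
    change _ ↔ (p.lex fun j => (q j).lex (r j)).lt ⟨j, ⟨i, a⟩⟩ ⟨j', ⟨i', b⟩⟩
    by_cases hj : j = j'
    · subst hj
      by_cases hi : i = i'
      · subst hi
        simp [TotalOrd.lex_lt_right]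
      · have hi' : (⟨j, i⟩ : Σ j, I j) ≠ ⟨j, i'⟩ := by simpa using hi
        simp [TotalOrd.lex_lt_right, TotalOrd.lex_lt_left _ _ hi, TotalOrd.lex_lt_left _ _ hi']
    · have hi' : (⟨j, i⟩ : Σ j, I j) ≠ ⟨j', i'⟩ := fun h => hj (congrArg Sigma.fst h)
      rw [TotalOrd.lex_lt_left _ _ hi', TotalOrd.lex_lt_left _ _ hj, TotalOrd.lex_lt_left _ _ hj]
  continuous_relabel _ := continuous_of_discreteTopology
  continuous_comp {J _ I _ K _ _ _} p q hp hq := by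
    have h : Continuous fun x => (p x, fun j => q j x) :=
      hp.prodMk (continuous_pi hq)
    exact (continuous_of_discreteTopology
      (f := fun y : TotalOrd J × (∀ j, TotalOrd (I j)) => y.1.lex y.2)).comp h

/-! ## The little cubes operad -/

/-- The space `C_n(1)` of little `n`-cubes: a little cube is determined by its lowest corner `x`
and its highest corner `y`, with `0 ≤ x i < y i ≤ 1`; it is the affine embedding of the unit cube
with parallel axes whose image is the product of the intervals `[x i, y i]`. -/
abbrev LittleCube (n : ℕ) : Type :=
  {c : (Fin n → ℝ) × (Fin n → ℝ) // ∀ i, 0 ≤ c.1 i ∧ c.1 i < c.2 i ∧ c.2 i ≤ 1}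

namespace LittleCube

variable {n : ℕ}

/-- The lowest corner. -/
def lo (c : LittleCube n) : Fin n → ℝ := c.1.1

/-- The highest corner. -/
def hi (c : LittleCube n) : Fin n → ℝ := c.1.2

/-- The affine map `ℝⁿ → ℝⁿ` given by a little cube. -/
def toMap (c : LittleCube n) (x : Fin n → ℝ) : Fin n → ℝ :=
  fun i => c.lo i + (c.hi i - c.lo i) * x i

/-- The interior of the image of a little cube, i.e. the image of the open unit cube. -/
def interior (c : LittleCube n) : Set (Fin n → ℝ) :=
  {x | ∀ i, c.lo i < x i ∧ x i < c.hi i}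

/-- Composition of little cubes as maps. -/
def comp (c d : LittleCube n) : LittleCube n :=
  ⟨(c.toMap d.lo, c.toMap d.hi), fun i => by
    have hc := c.2 i
    have hd := d.2 i
    simp only [toMap, lo, hi]
    refine ⟨?_, ?_, ?_⟩ <;> nlinarith⟩

/-- The identity cube. -/
def id (n : ℕ) : LittleCube n := ⟨(fun _ => 0, fun _ => 1), fun _ => by norm_num⟩

@[ext] theorem ext {c d : LittleCube n} (h : ∀ i, c.lo i = d.lo i) (h' : ∀ i, c.hi i = d.hi i) :
    c = d :=
  Subtype.ext (Prod.ext (funext h) (funext h'))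

theorem comp_assoc (c d e : LittleCube n) : (c.comp d).comp e = c.comp (d.comp e) := by
  ext i <;> simp [comp, toMap, lo, hi] <;> ring

theorem id_comp (c : LittleCube n) : (id n).comp c = c := by
  ext i <;> simp [comp, toMap, lo, hi, id]

theorem comp_id (c : LittleCube n) : c.comp (id n) = c := by
  ext i <;> simp [comp, toMap, lo, hi, id]

theorem mem_interior_comp {c d : LittleCube n} {x : Fin n → ℝ} (h : x ∈ (c.comp d).interior) :
    (fun i => (x i - c.lo i) / (c.hi i - c.lo i)) ∈ d.interior := by
  intro i
  have hx : c.lo i + (c.hi i - c.lo i) * d.lo i < x i ∧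
    x i < c.lo i + (c.hi i - c.lo i) * d.hi i := h i
  have hc : 0 < c.hi i - c.lo i := sub_pos.2 (c.2 i).2.1
  constructor
  · rw [lt_div_iff₀ hc]; nlinarith [hx.1]
  · rw [div_lt_iff₀ hc]; nlinarith [hx.2]

theorem interior_comp_subset (c d : LittleCube n) : (c.comp d).interior ⊆ c.interior := by
  intro x h i
  have hx : c.lo i + (c.hi i - c.lo i) * d.lo i < x i ∧
    x i < c.lo i + (c.hi i - c.lo i) * d.hi i := h i
  have hc : 0 < c.hi i - c.lo i := sub_pos.2 (c.2 i).2.1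
  have h0 : 0 ≤ d.lo i := (d.2 i).1
  have h1 : d.hi i ≤ 1 := (d.2 i).2.2
  constructor <;> nlinarith [hx.1, hx.2, mul_nonneg hc.le h0, mul_le_mul_of_nonneg_left h1 hc.le]

theorem continuous_comp :
    Continuous (fun p : LittleCube n × LittleCube n => p.1.comp p.2) := by
  refine Continuous.subtype_mk ?_ _
  unfold toMap lo hi
  fun_prop

/-- Two little cubes with disjoint interiors, i.e. `(c, d) ∈ C_n(2)`. -/
def DisjointInteriors (c d : LittleCube n) : Prop := Disjoint c.interior d.interior

theorem DisjointInteriors.mono {c d : LittleCube n} (h : c.DisjointInteriors d)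
    (c' d' : LittleCube n) : (c.comp c').DisjointInteriors (d.comp d') :=
  Disjoint.mono (interior_comp_subset _ _) (interior_comp_subset _ _) h

theorem DisjointInteriors.comp_left (c : LittleCube n) {d d' : LittleCube n}
    (h : d.DisjointInteriors d') : (c.comp d).DisjointInteriors (c.comp d') := by
  refine Set.disjoint_left.2 fun x hx hx' => ?_
  exact Set.disjoint_left.1 h (mem_interior_comp hx) (mem_interior_comp hx')

/-- The strict order `c <_i d`: in the `i`-th coordinate the highest corner of `c` is at most
the lowest corner of `d`. -/
def LtDir (i : Fin n) (c d : LittleCube n) : Prop := c.hi i ≤ d.lo i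

end LittleCube

/-- The space of families of little `n`-cubes, indexed by `I`, with pairwise disjoint interiors. -/
abbrev LittleCubes (n : ℕ) (I : Type) : Type :=
  {c : I → LittleCube n // Pairwise fun p q => (c p).DisjointInteriors (c q)}

/-- The little `n`-cubes operad `C_n`. -/
def cubesOperad (n : ℕ) : TopOperad where
  Op I _ := LittleCubes n I
  top I _ := instTopologicalSpaceSubtype
  kspace I _ := by
    have h1 : FirstCountableTopology (LittleCube n) := inferInstance
    have h2 : FirstCountableTopology (I → LittleCube n) := inferInstance
    have : FirstCountableTopology (LittleCubes n I) :=
      Topology.IsInducing.subtypeVal.firstCountableTopology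
    infer_instance
  relabel e c := ⟨fun j => c.1 (e.symm j), fun _ _ h => c.2 (fun h' => h (e.symm.injective h'))⟩
  one := ⟨fun _ => LittleCube.id n, fun _ _ h => (h rfl).elim⟩
  comp c d := ⟨fun x => (c.1 x.1).comp ((d x.1).1 x.2), by
    rintro ⟨j, a⟩ ⟨j', b⟩ h
    by_cases hj : j = j'
    · subst hj
      exact LittleCube.DisjointInteriors.comp_left _ ((d j).2 (fun hab => h (congrArg (Sigma.mk j) hab)))
    · exact LittleCube.DisjointInteriors.mono (c.2 hj) _ _⟩
  relabel_refl _ := rfl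
  relabel_trans _ _ _ := rfl
  comp_relabel_right _ _ _ := rfl
  comp_relabel_left {J J' _ _ I _} e p q := by
    apply Subtype.ext
    funext x
    obtain ⟨⟨j, a⟩, rfl⟩ := (Equiv.sigmaCongrLeft (β := I) e).surjective x
    dsimp only
    rw [Equiv.symm_apply_apply]
    simp [Equiv.sigmaCongrLeft]
  one_comp p := by
    apply Subtype.ext
    funext x
    exact LittleCube.id_comp _
  comp_one p := by
    apply Subtype.ext
    funext x
    exact LittleCube.comp_id _
  comp_assoc p q r := by
    apply Subtype.ext
    funext x
    exact LittleCube.comp_assoc _ _ _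
  continuous_relabel e := by
    refine Continuous.subtype_mk (continuous_pi fun x => ?_) _
    exact (continuous_apply _).comp continuous_subtype_val
  continuous_comp p q hp hq := by
    refine Continuous.subtype_mk (continuous_pi fun x => ?_) _
    exact LittleCube.continuous_comp.comp
      (((continuous_apply x.1).comp (continuous_subtype_val.comp hp)).prodMk
        ((continuous_apply x.2).comp (continuous_subtype_val.comp (hq x.1))))

/-- A little cube as a unary operation. -/
def LittleCube.unary {n : ℕ} (c : LittleCube n) : (cubesOperad n).Op Unit :=
  (⟨fun _ => c, fun _ _ h => (h rfl).elim⟩ : LittleCubes n Unit)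

/-- The operation `(x_p)_p ↦ ∏_p c_p (x_p)`, the product being taken in the order `t`, of an operad
`P` that receives maps from `Ass` and `C_n`. -/
def orderedProduct {n : ℕ} {P : TopOperad} (i : TopOperad.Hom assOperad P)
    (j : TopOperad.Hom (cubesOperad n) P) {I : Type} [Finite I] (t : TotalOrd I)
    (c : I → LittleCube n) : P.Op I :=
  P.relabel (Equiv.sigmaPUnit I) (P.comp (i.toFun (I := I) t) (fun p => j.toFun (c p).unary))

/-! ## The complete graphs posets -/

/-- The complete graph on the vertex set `V` with a partial colouring (colours `1, 2, 3, …`) of its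
edges and a partial monochrome acyclic orientation: every edge is either uncoloured and unoriented,
or both coloured and oriented, and no colour has a directed cycle. `edge a b = some i` says that
the edge between `a` and `b` is oriented from `a` to `b` and has colour `i`. (On finitely many
vertices these are exactly the graphs obtained from fully coloured and oriented ones by forgetting
the colours and orientations of a set of edges: give the remaining edges, oriented along a total
order of `V`, a new colour.) -/
@[ext] structure PartialGraph (V : Type) where
  /-- The coloured oriented edges. -/
  edge : V → V → Option ℕ
  one_le : ∀ a b i, edge a b = some i → 1 ≤ i
  asymm : ∀ a b i, edge a b = some i → edge b a = none
  acyclic : ∀ i a, ¬ Relation.TransGen (fun x y => edge x y = some i) a a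

namespace PartialGraph

variable {V : Type}

/-- The edge between `a` and `b` is uncoloured and unoriented. -/
def Blank (g : PartialGraph V) (a b : V) : Prop := g.edge a b = none ∧ g.edge b a = none

/-- The set of coloured (and oriented) edges. -/
def coloredEdges (g : PartialGraph V) : Set (Sym2 V) :=
  {e | ∃ a b i, e = s(a, b) ∧ g.edge a b = some i}

theorem mem_coloredEdges {g : PartialGraph V} {a b : V} :
    s(a, b) ∈ g.coloredEdges ↔ ¬ g.Blank a b := by
  constructor
  · rintro ⟨x, y, i, h, hi⟩ ⟨h1, h2⟩
    rcases Sym2.eq_iff.1 h with ⟨rfl, rfl⟩ | ⟨rfl, rfl⟩ <;> simp_all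
  · intro h
    by_cases h1 : g.edge a b = none
    · obtain ⟨i, hi⟩ := Option.ne_none_iff_exists'.1 (fun h2 => h ⟨h1, h2⟩)
      exact ⟨b, a, i, Sym2.eq_swap, hi⟩
    · obtain ⟨i, hi⟩ := Option.ne_none_iff_exists'.1 h1
      exact ⟨a, b, i, rfl, hi⟩

theorem edge_self (g : PartialGraph V) (a : V) : g.edge a a = none := by
  by_contra h
  obtain ⟨i, hi⟩ := Option.ne_none_iff_exists'.1 h
  exact h (g.asymm a a i hi)

theorem Blank.symm {g : PartialGraph V} {a b : V} (h : g.Blank a b) : g.Blank b a := ⟨h.2, h.1⟩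

open Classical in
/-- Forget the colours and orientations of the edges in `S`. -/
noncomputable def forget (g : PartialGraph V) (S : Set (Sym2 V)) : PartialGraph V where
  edge a b := if s(a, b) ∈ S then none else g.edge a b
  one_le a b i h := by
    split_ifs at h
    exact g.one_le a b i h
  asymm a b i h := by
    rw [Sym2.eq_swap]
    split_ifs at h ⊢
    exact g.asymm a b i h
  acyclic i a h := by
    refine g.acyclic i a (Relation.TransGen.mono (fun x y hxy => ?_) _ _ h)
    split_ifs at hxy
    exact hxy

theorem forget_edge_of_mem (g : PartialGraph V) {S : Set (Sym2 V)} {a b : V} (h : s(a, b) ∈ S) :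
    (g.forget S).edge a b = none := if_pos h

theorem forget_edge_of_notMem (g : PartialGraph V) {S : Set (Sym2 V)} {a b : V}
    (h : s(a, b) ∉ S) : (g.forget S).edge a b = g.edge a b := if_neg h

theorem forget_edge_eq_some {g : PartialGraph V} {S : Set (Sym2 V)} {a b : V} {i : ℕ} :
    (g.forget S).edge a b = some i ↔ s(a, b) ∉ S ∧ g.edge a b = some i := by
  by_cases h : s(a, b) ∈ S
  · simp [forget_edge_of_mem g h, h]
  · simp [forget_edge_of_notMem g h, h]

/-- `g ≤ h` iff every uncoloured edge of `g` is uncoloured in `h` and every edge `a → b` of `g` of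
colour `i` is, in `h`, uncoloured, or of the form `a → b` with colour `j ≥ i`, or of the form
`b → a` with colour `j > i`. -/
instance : PartialOrder (PartialGraph V) where
  le g h := (∀ a b, g.Blank a b → h.Blank a b) ∧
    ∀ a b i, g.edge a b = some i →
      h.Blank a b ∨ (∃ j, i ≤ j ∧ h.edge a b = some j) ∨ ∃ j, i < j ∧ h.edge b a = some j
  le_refl g := ⟨fun _ _ h => h, fun _ _ i h => Or.inr (Or.inl ⟨i, le_rfl, h⟩)⟩
  le_trans g h l h1 h2 := by
    refine ⟨fun a b hab => h2.1 a b (h1.1 a b hab), fun a b i hi => ?_⟩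
    rcases h1.2 a b i hi with hb | ⟨j, hij, hj⟩ | ⟨j, hij, hj⟩
    · exact Or.inl (h2.1 a b hb)
    · rcases h2.2 a b j hj with hb | ⟨m, hm, h'⟩ | ⟨m, hm, h'⟩
      · exact Or.inl hb
      · exact Or.inr (Or.inl ⟨m, hij.trans hm, h'⟩)
      · exact Or.inr (Or.inr ⟨m, hij.trans_lt hm, h'⟩)
    · rcases h2.2 b a j hj with hb | ⟨m, hm, h'⟩ | ⟨m, hm, h'⟩
      · exact Or.inl hb.symm
      · exact Or.inr (Or.inr ⟨m, hij.trans_le hm, h'⟩)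
      · exact Or.inr (Or.inl ⟨m, (hij.trans hm).le, h'⟩)
  le_antisymm g h h1 h2 := by
    have key : ∀ g h : PartialGraph V,
        ((∀ a b, g.Blank a b → h.Blank a b) ∧ ∀ a b i, g.edge a b = some i →
          h.Blank a b ∨ (∃ j, i ≤ j ∧ h.edge a b = some j) ∨ ∃ j, i < j ∧ h.edge b a = some j) →
        ((∀ a b, h.Blank a b → g.Blank a b) ∧ ∀ a b i, h.edge a b = some i →
          g.Blank a b ∨ (∃ j, i ≤ j ∧ g.edge a b = some j) ∨ ∃ j, i < j ∧ g.edge b a = some j) →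
        ∀ a b i, g.edge a b = some i → h.edge a b = some i := by
      intro g h h1 h2 a b i hi
      have hba := g.asymm a b i hi
      rcases h1.2 a b i hi with hb | ⟨j, hij, hj⟩ | ⟨j, hij, hj⟩
      · have := (h2.1 a b hb).1
        simp_all
      · rcases h2.2 a b j hj with hb | ⟨m, hm, h'⟩ | ⟨m, hm, h'⟩
        · have := hb.1
          simp_all
        · have hmi : i = m := by simpa [hi] using h'
          have : j = i := by omega
          rw [hj, this]
        · simp_all
      · rcases h2.2 b a j hj with hb | ⟨m, hm, h'⟩ | ⟨m, hm, h'⟩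
        · have := hb.2
          simp_all
        · simp_all
        · have hmi : i = m := by simpa [hi] using h'
          omega
    ext a b i
    exact ⟨key g h h1 h2 a b i, key h g h2 h1 a b i⟩

end PartialGraph

/-- The poset `K̂_n(k)` of augmented complete graphs on `k` vertices with colours in `{1, …, n}`. -/
abbrev KHat (n k : ℕ) : Type :=
  {g : PartialGraph (Fin k) // ∀ a b i, g.edge a b = some i → i ≤ n}

/-- The poset `K_n(k)` of complete graphs on `k` vertices all of whose edges are coloured, with
colours in `{1, …, n}`, and oriented without monochrome directed cycles. -/
abbrev KFull (n k : ℕ) : Type :=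
  {g : PartialGraph (Fin k) // (∀ a b i, g.edge a b = some i → i ≤ n) ∧
    ∀ a b, a ≠ b → ¬ g.Blank a b}

section

variable {n k : ℕ}

/-- `m` is a graph in `K̂_n(k)` complementary to `l ∈ K̂_1(k)`: it is obtained from an element of
`K_{n+1}(k)`, in which the coloured edges of `l` have their orientation from `l` and the colour
`n + 1`, by forgetting the colours and orientations of these edges. -/
def IsComplementary (l : KHat 1 k) (m : KHat n k) : Prop :=
  ∃ f : KFull (n + 1) k,
    (∀ a b i, l.1.edge a b = some i → f.1.edge a b = some (n + 1)) ∧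
    m.1 = f.1.forget l.1.coloredEdges

variable (n k) in
/-- The poset `T_k(l)` of the graphs in `K̂_n(k)` complementary to `l`. -/
abbrev TPoset (l : KHat 1 k) : Type := {m : KHat n k // IsComplementary l m}

/-- A graph is complementary to `l` iff its uncoloured edges are the coloured edges of `l`. -/
theorem isComplementary_iff (l : KHat 1 k) (m : KHat n k) :
    IsComplementary l m ↔ ∀ a b, a ≠ b → (m.1.Blank a b ↔ ¬ l.1.Blank a b) := by
  classical
  constructor
  · rintro ⟨f, _, hf⟩ a b hab
    rw [← PartialGraph.mem_coloredEdges]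
    constructor
    · intro h
      by_contra hS
      refine f.2.2 a b hab ⟨?_, ?_⟩
      · rw [← PartialGraph.forget_edge_of_notMem f.1 hS, ← hf]; exact h.1
      · rw [Sym2.eq_swap] at hS
        rw [← PartialGraph.forget_edge_of_notMem f.1 hS, ← hf]; exact h.2
    · intro hS
      refine ⟨?_, ?_⟩
      · rw [hf, PartialGraph.forget_edge_of_mem _ hS]
      · rw [Sym2.eq_swap] at hS
        rw [hf, PartialGraph.forget_edge_of_mem _ hS]
  · intro H
    have hl : ∀ a b, ¬ l.1.Blank a b → m.1.edge a b = none := by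
      intro a b h
      by_cases hab : a = b
      · subst hab; exact m.1.edge_self a
      · exact ((H a b hab).2 h).1
    let E : Fin k → Fin k → Option ℕ := fun a b =>
      if (l.1.edge a b).isSome then some (n + 1) else m.1.edge a b
    have hE1 : ∀ a b i, l.1.edge a b = some i → E a b = some (n + 1) := by
      intro a b i h
      simp [E, h]
    have hE2 : ∀ a b, l.1.edge a b = none → E a b = m.1.edge a b := by
      intro a b h
      simp [E, h]
    have hle : ∀ a b i, E a b = some i → 1 ≤ i ∧ i ≤ n + 1 := by
      intro a b i h
      rcases hab : l.1.edge a b with _ | j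
      · rw [hE2 a b hab] at h
        exact ⟨m.1.one_le a b i h, (m.2 a b i h).trans (Nat.le_succ n)⟩
      · rw [hE1 a b j hab] at h
        simp at h
        omega
    refine ⟨⟨⟨E, fun a b i h => (hle a b i h).1, ?_, ?_⟩, fun a b i h => (hle a b i h).2, ?_⟩,
      hE1, ?_⟩
    · intro a b i h
      rcases hab : l.1.edge a b with _ | j
      · rw [hE2 a b hab] at h
        have hba : l.1.edge b a = none := by
          by_contra hba
          have := hl a b (fun hb => hba hb.2)
          simp_all
        rw [hE2 b a hba]
        exact m.1.asymm a b i h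
      · have hba := l.1.asymm a b j hab
        rw [hE2 b a hba]
        exact hl b a (fun hb => by simp [hb.2] at hab)
    · intro i a h
      by_cases hi : i = n + 1
      · subst hi
        refine l.1.acyclic 1 a (Relation.TransGen.mono (fun x y hxy => ?_) _ _ h)
        rcases hab : l.1.edge x y with _ | j
        · rw [hE2 x y hab] at hxy
          have := m.2 x y _ hxy
          omega
        · have h1 := l.2 x y j hab
          have h2 := l.1.one_le x y j hab
          have : j = 1 := by omega
          rw [this]
      · refine m.1.acyclic i a (Relation.TransGen.mono (fun x y hxy => ?_) _ _ h)
        rcases hab : l.1.edge x y with _ | j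
        · rwa [hE2 x y hab] at hxy
        · rw [hE1 x y j hab] at hxy
          simp at hxy
          omega
    · intro a b hab hb
      by_cases h : l.1.Blank a b
      · refine (H a b hab).not.2 (not_not.2 h) ⟨?_, ?_⟩
        · rw [← hE2 a b h.1]; exact hb.1
        · rw [← hE2 b a h.2]; exact hb.2
      · have h' : l.1.edge a b ≠ none ∨ l.1.edge b a ≠ none := by
          by_contra hc
          push Not at hc
          exact h hc
        rcases h' with h' | h' <;> obtain ⟨i, hi⟩ := Option.ne_none_iff_exists'.1 h'
        · have : E a b = none := hb.1
          simp [hE1 a b i hi] at this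
        · have : E b a = none := hb.2
          simp [hE1 b a i hi] at this
    · ext a b : 3
      by_cases h : l.1.Blank a b
      · rw [PartialGraph.forget_edge_of_notMem _ (by simpa [PartialGraph.mem_coloredEdges] using h)]
        exact (hE2 a b h.1).symm
      · rw [PartialGraph.forget_edge_of_mem _ (PartialGraph.mem_coloredEdges.2 h)]
        exact hl a b h

theorem KHat.blank_of_le {l l' : KHat 1 k} (h : l' ≤ l) {a b : Fin k} (hb : l'.1.Blank a b) :
    l.1.Blank a b := h.1 a b hb

/-- In `K̂_1(k)` a relation `l' ≤ l` means that `l` is obtained from `l'` by forgetting edges. -/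
theorem KHat.edge_of_le {l l' : KHat 1 k} (h : l' ≤ l) {a b : Fin k} {i : ℕ}
    (hi : l.1.edge a b = some i) : l'.1.edge a b = some i := by
  have h1 : i = 1 := le_antisymm (l.2 a b i hi) (l.1.one_le a b i hi)
  have hba := l.1.asymm a b i hi
  have hnb : ¬ l'.1.Blank a b := fun hb => by
    have := (h.1 a b hb).1
    simp_all
  have hone : ∀ x y j, l'.1.edge x y = some j → j = 1 := fun x y j hj =>
    le_antisymm (l'.2 x y j hj) (l'.1.one_le x y j hj)
  rcases hab : l'.1.edge a b with _ | j
  · obtain ⟨j, hj⟩ := Option.ne_none_iff_exists'.1 (fun h2 => hnb ⟨hab, h2⟩)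
    have hj1 := hone _ _ _ hj
    rcases h.2 b a j hj with hb | ⟨m, hm, h'⟩ | ⟨m, hm, h'⟩
    · have := hb.2
      simp_all
    · simp_all
    · have := l.2 _ _ _ h'
      omega
  · rw [hone _ _ _ hab, h1]

/-- The map of posets `T_k(l) → T_k(l')` for `l' ≤ l` in `K̂_1(k)`: forget the colours and
orientations of all edges that are coloured in `l'`. -/
noncomputable def TMap {l l' : KHat 1 k} (h : l' ≤ l) : TPoset n k l →o TPoset n k l' where
  toFun m := ⟨⟨m.1.1.forget l'.1.coloredEdges, fun a b i hi =>
      m.1.2 a b i (PartialGraph.forget_edge_eq_some.1 hi).2⟩, by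
    rw [isComplementary_iff]
    intro a b hab
    have H := (isComplementary_iff l m.1).1 m.2 a b hab
    rw [← PartialGraph.mem_coloredEdges]
    constructor
    · intro hb
      by_contra hS
      have hS' : s(b, a) ∉ l'.1.coloredEdges := by rwa [Sym2.eq_swap]
      have hm : m.1.1.Blank a b := by
        refine ⟨?_, ?_⟩
        · rw [← PartialGraph.forget_edge_of_notMem _ hS]; exact hb.1
        · rw [← PartialGraph.forget_edge_of_notMem _ hS']; exact hb.2
      have hbl : l'.1.Blank a b := by
        by_contra hc
        exact hS (PartialGraph.mem_coloredEdges.2 hc)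
      exact H.1 hm (KHat.blank_of_le h hbl)
    · intro hS
      refine ⟨PartialGraph.forget_edge_of_mem _ hS, PartialGraph.forget_edge_of_mem _ ?_⟩
      rwa [Sym2.eq_swap]⟩
  monotone' := by
    intro m m' hm
    change PartialGraph.forget _ _ ≤ PartialGraph.forget _ _
    refine ⟨fun a b hb => ?_, fun a b i hi => ?_⟩
    · by_cases hS : s(a, b) ∈ l'.1.coloredEdges
      · refine ⟨PartialGraph.forget_edge_of_mem _ hS, PartialGraph.forget_edge_of_mem _ ?_⟩
        rwa [Sym2.eq_swap]
      · have hS' : s(b, a) ∉ l'.1.coloredEdges := by rwa [Sym2.eq_swap]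
        unfold PartialGraph.Blank at hb ⊢
        rw [PartialGraph.forget_edge_of_notMem _ hS,
          PartialGraph.forget_edge_of_notMem _ hS'] at hb ⊢
        exact hm.1 a b hb
    · obtain ⟨hS, hi⟩ := PartialGraph.forget_edge_eq_some.1 hi
      have hS' : s(b, a) ∉ l'.1.coloredEdges := by rwa [Sym2.eq_swap]
      unfold PartialGraph.Blank
      rw [PartialGraph.forget_edge_of_notMem _ hS, PartialGraph.forget_edge_of_notMem _ hS']
      exact hm.2 a b i hi

theorem TMap_edge_eq_some {l l' : KHat 1 k} (h : l' ≤ l) (m : TPoset n k l) {a b : Fin k} {i : ℕ} :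
    (TMap h m).1.1.edge a b = some i ↔ s(a, b) ∉ l'.1.coloredEdges ∧ m.1.1.edge a b = some i :=
  PartialGraph.forget_edge_eq_some

theorem TMap_refl (l : KHat 1 k) (m : TPoset n k l) : TMap (le_refl l) m = m := by
  apply Subtype.ext
  apply Subtype.ext
  ext a b i
  change (TMap (le_refl l) m).1.1.edge a b = some i ↔ _
  rw [TMap_edge_eq_some]
  refine ⟨fun h => h.2, fun h => ⟨fun hS => ?_, h⟩⟩
  by_cases hab : a = b
  · subst hab
    simp [PartialGraph.edge_self] at h
  · have := (((isComplementary_iff l m.1).1 m.2 a b hab).2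
      (PartialGraph.mem_coloredEdges.1 hS)).1
    simp_all

theorem TMap_trans {l l' l'' : KHat 1 k} (h : l' ≤ l) (h' : l'' ≤ l') (m : TPoset n k l) :
    TMap (h'.trans h) m = TMap h' (TMap h m) := by
  apply Subtype.ext
  apply Subtype.ext
  ext a b i
  change (TMap (h'.trans h) m).1.1.edge a b = some i ↔ (TMap h' (TMap h m)).1.1.edge a b = some i
  rw [TMap_edge_eq_some, TMap_edge_eq_some, TMap_edge_eq_some]
  refine ⟨fun H => ⟨H.1, fun hS => ?_, H.2⟩, fun H => ⟨H.1, H.2.2⟩⟩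
  rw [PartialGraph.mem_coloredEdges] at hS
  refine H.1 (PartialGraph.mem_coloredEdges.2 fun hb => hS (KHat.blank_of_le h' hb))

variable (n k) in
/-- The functor `T_k` from `K̂_1(k)ᵒᵖ` to posets, regarded as categories. -/
noncomputable def TFunctor : (KHat 1 k)ᵒᵖ ⥤ Cat.{0, 0} where
  obj l := Cat.of (TPoset n k l.unop)
  map f := (TMap (n := n) (leOfHom f.unop)).monotone.functor.toCatHom
  map_id l := by
    apply Cat.ext
    refine CategoryTheory.Functor.ext (fun m => ?_) (fun _ _ _ => rfl)
    exact TMap_refl l.unop m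
  map_comp f g := by
    apply Cat.ext
    refine CategoryTheory.Functor.ext (fun m => ?_) (fun _ _ _ => rfl)
    exact TMap_trans (leOfHom f.unop) (leOfHom g.unop) m

variable (n k) in
/-- The Grothendieck construction `K̂_1(k)ᵒᵖ ∫ T_k`. -/
abbrev GrothT : Type := Grothendieck (TFunctor n k)

/-- The first component, in `K̂_1(k)`, of an object of `K̂_1(k)ᵒᵖ ∫ T_k`. -/
def GrothT.fst (X : GrothT n k) : KHat 1 k := X.base.unop

/-- The second component, in `T_k` of the first one. -/
def GrothT.snd (X : GrothT n k) : TPoset n k X.fst := X.fiber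

/-! ## The diagrams of spaces -/

variable (n) in
/-- `A(l)`: the vertex labels of `l` by little cubes such that the labels of the end points of an
uncoloured edge have disjoint interiors. -/
def ASet (l : KHat 1 k) : Set (Fin k → LittleCube n) :=
  {c | ∀ p q, p ≠ q → l.1.Blank p q → (c p).DisjointInteriors (c q)}

/-- `H(m)`: the tuples of cubes with `c_p <_i c_q` whenever `m` has an edge `p → q` of colour `i`.
(The colours `1, …, n` number the coordinates `0, …, n - 1` of `Fin n`.) -/
def HSet (m : KHat n k) : Set (Fin k → LittleCube n) :=
  {c | ∀ p q, ∀ i : Fin n, m.1.edge p q = some (i.1 + 1) → (c p).LtDir i (c q)}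

/-- `F_k(l)(m)`: the union of the `H(m')` over all `m' ≤ m` in `T_k(l)`. -/
def FSet (l : KHat 1 k) (m : TPoset n k l) : Set (Fin k → LittleCube n) :=
  {c | ∃ m' : TPoset n k l, m' ≤ m ∧ c ∈ HSet m'.1}

theorem ASet_mono {l l' : KHat 1 k} (h : l' ≤ l) : ASet n l ⊆ ASet n l' :=
  fun _ hc p q hpq hb => hc p q hpq (KHat.blank_of_le h hb)

theorem FSet_mono {l : KHat 1 k} {m m' : TPoset n k l} (h : m ≤ m') : FSet l m ⊆ FSet l m' :=
  fun _ ⟨x, hx, hc⟩ => ⟨x, hx.trans h, hc⟩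

theorem FSet_TMap {l l' : KHat 1 k} (h : l' ≤ l) (m : TPoset n k l) :
    FSet l m ⊆ FSet l' (TMap h m) := by
  rintro c ⟨x, hx, hc⟩
  refine ⟨TMap h x, (TMap h).monotone hx, fun p q i hi => hc p q i ?_⟩
  exact ((TMap_edge_eq_some h x).1 hi).2

/-- The inclusion of a subspace into a larger one, as a morphism of topological spaces. -/
def inclHom {X : Type} [TopologicalSpace X] {S S' : Set X} (h : S ⊆ S') :
    TopCat.of S ⟶ TopCat.of S' :=
  TopCat.ofHom ⟨Set.inclusion h, continuous_inclusion h⟩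

variable (n k) in
/-- The diagram `A : K̂_1(k)ᵒᵖ ⥤ Top`. -/
def ADiagram : (KHat 1 k)ᵒᵖ ⥤ TopCat.{0} where
  obj l := TopCat.of (ASet n l.unop)
  map f := inclHom (ASet_mono (leOfHom f.unop))

variable (n) in
/-- The diagram `F_k(l) : T_k(l) ⥤ Top`. -/
def FFiber (l : KHat 1 k) : TPoset n k l ⥤ TopCat.{0} where
  obj m := TopCat.of (FSet l m)
  map f := inclHom (FSet_mono (leOfHom f))

theorem FSet_hom {X Y : GrothT n k} (f : X ⟶ Y) : FSet X.fst X.snd ⊆ FSet Y.fst Y.snd :=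
  (FSet_TMap (leOfHom f.base.unop) X.snd).trans (FSet_mono (leOfHom f.fiber))

variable (n k) in
/-- The diagram `F_k : K̂_1(k)ᵒᵖ ∫ T_k ⥤ Top`, `(l, m) ↦ F_k(l)(m)`. -/
def FDiagram : GrothT n k ⥤ TopCat.{0} where
  obj X := TopCat.of (FSet X.fst X.snd)
  map f := inclHom (FSet_hom f)

/-- The inclusion into `T_k(l)` of its subposet of elements smaller than `m`. -/
def belowIncl {l : KHat 1 k} (m : TPoset n k l) : Set.Iio m ⥤ TPoset n k l :=
  (Subtype.mono_coe (· ∈ Set.Iio m)).functor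

/-! ## The comparison of `K_{n+1}(k)` with the Grothendieck construction -/

/-- Keep only the edges of colour `n + 1` and give them the colour `1`. -/
def phiOne (g : KFull (n + 1) k) : KHat 1 k :=
  ⟨{ edge := fun a b => if g.1.edge a b = some (n + 1) then some 1 else none
     one_le := fun a b i h => by
       split_ifs at h
       simp at h
       omega
     asymm := fun a b i h => by
       split_ifs at h with h1
       simp [g.1.asymm a b _ h1]
     acyclic := fun i a h => by
       refine g.1.acyclic (n + 1) a (Relation.TransGen.mono (fun x y hxy => ?_) _ _ h)
       split_ifs at hxy with h1
       exact h1 }, fun a b i h => by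
    dsimp only at h
    split_ifs at h
    simp at h
    omega⟩

/-- Forget the colours and orientations of all edges of colour `n + 1`. -/
def phiTwo (g : KFull (n + 1) k) : KHat n k :=
  ⟨{ edge := fun a b => if g.1.edge a b = some (n + 1) then none else g.1.edge a b
     one_le := fun a b i h => by
       split_ifs at h
       exact g.1.one_le a b i h
     asymm := fun a b i h => by
       split_ifs at h
       simp [g.1.asymm a b i h]
     acyclic := fun i a h => by
       refine g.1.acyclic i a (Relation.TransGen.mono (fun x y hxy => ?_) _ _ h)
       split_ifs at hxy
       exact hxy }, fun a b i h => by
    dsimp only at h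
    split_ifs at h with h1
    have := g.2.1 a b i h
    have h2 : i ≠ n + 1 := fun h2 => h1 (by rw [h, h2])
    omega⟩

end

/-! The operad `Ass ⊗ C_n` is constructed explicitly. An operation with inputs `I` is a family of
little cubes indexed by `I`, which may overlap, together with a total order of `I` of which only
the restriction to pairs of overlapping cubes is remembered (`OrderedCubes`). It stands for the
product, in this order, of the unary operations given by the cubes. The space of operations is a
quotient of finitely many copies of `C_n(1)^I`, glued along closed subsets; hence the quotient map
is proper, products of such maps are again quotient maps, and composition is continuous.

For the universal property, let `D` receive an interchanging pair of maps from `Ass` and `C_n`.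
Plugging units into the interchange relation off the diagonal shows that a family of cubes with
pairwise disjoint interiors is the product of its members in any order
(`TopOperad.Interchange.orderedProduct_of_pairwise`). So adjacent factors with disjoint cubes may be
exchanged, and bubble sort shows that a product depends only on the order of the overlapping pairs
(`TopOperad.Interchange.orderedProduct_congr`). Since cubes distribute over products, ordered
products define the required map out of `OrderedCubes`.

The colimit statements are obtained by evaluating a cocone on the graphs of total orders `t`, where
both diagrams have the value `C_n(1)^k`. Two orders that agree on the overlapping pairs of `c` are
compared through the graph that colours exactly these pairs (`TotalOrd.overlapGraph`). For `F_k`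
one uses moreover that, among the graphs `m` in `T_k(l)` with `c ∈ H(m)`, there is a smallest one:
it orients each edge by the first direction in which the two cubes are comparable (`minGraph`).
Hence `c ∈ F_k(l)(m)` iff this graph is `≤ m`, so that the points of the spaces `F_k(l)(m)` lying
over `c` are identified in the colimit, also over the elements below a given one, and the topology
is right because these spaces form a finite closed cover. The isomorphism of categories is a
bijection between objects that preserves and reflects the existence of (unique) morphisms. -/

open TopOperad

/-! ### Little cubes and total orders -/

namespace LittleCube

variable {n : ℕ}

/-- For axis-parallel cubes, disjointness of the interiors is seen in a single coordinate. -/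
theorem disjointInteriors_iff {c d : LittleCube n} :
    c.DisjointInteriors d ↔ ∃ i, c.LtDir i d ∨ d.LtDir i c := by
  constructor
  · intro h
    by_contra hcon
    push Not at hcon
    -- otherwise the midpoints of the overlaps of the sides form a common interior point
    refine (Set.disjoint_left.1 h : ∀ ⦃x⦄, x ∈ c.interior → x ∉ d.interior)
      (show (fun i => (max (c.lo i) (d.lo i) + min (c.hi i) (d.hi i)) / 2) ∈ _ from fun i => ?_)
      (fun i => ?_) <;>
    · obtain ⟨h1, h2⟩ := hcon i
      have h1' : d.lo i < c.hi i := not_le.1 h1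
      have h2' : c.lo i < d.hi i := not_le.1 h2
      have hc : c.lo i < c.hi i := (c.2 i).2.1
      have hd : d.lo i < d.hi i := (d.2 i).2.1
      rcases max_cases (c.lo i) (d.lo i) with ⟨e, _⟩ | ⟨e, _⟩ <;>
      rcases min_cases (c.hi i) (d.hi i) with ⟨e', _⟩ | ⟨e', _⟩ <;>
      simp only [e, e'] <;> constructor <;> linarith
  · rintro ⟨i, h | h⟩ <;> refine Set.disjoint_left.2 fun x hx hx' => ?_
    · exact absurd ((hx' i).1.trans (hx i).2) (not_lt.2 h)
    · exact absurd ((hx i).1.trans (hx' i).2) (not_lt.2 h)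

theorem DisjointInteriors.symm {c d : LittleCube n} (h : c.DisjointInteriors d) :
    d.DisjointInteriors c := Disjoint.symm h

theorem LtDir.trans {i : Fin n} {c d e : LittleCube n} (h : c.LtDir i d) (h' : d.LtDir i e) :
    c.LtDir i e :=
  le_trans (α := ℝ) h ((d.2 i).2.1.le.trans h')

theorem LtDir.asymm {i : Fin n} {c d : LittleCube n} (h : c.LtDir i d) : ¬ d.LtDir i c :=
  fun h' => absurd ((h.trans_lt (d.2 i).2.1).trans_le h') (not_lt.2 (c.2 i).2.1.le)

theorem isClosed_ltDir {X : Type*} [TopologicalSpace X] {f g : X → LittleCube n}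
    (hf : Continuous f) (hg : Continuous g) (i : Fin n) :
    IsClosed {x | (f x).LtDir i (g x)} := by
  refine isClosed_le (f := fun x => (f x).hi i) (g := fun x => (g x).lo i) ?_ ?_
  · exact (continuous_apply i).comp (continuous_snd.comp (continuous_subtype_val.comp hf))
  · exact (continuous_apply i).comp (continuous_fst.comp (continuous_subtype_val.comp hg))

theorem isClosed_disjointInteriors {X : Type*} [TopologicalSpace X] {f g : X → LittleCube n}
    (hf : Continuous f) (hg : Continuous g) :
    IsClosed {x | (f x).DisjointInteriors (g x)} := by
  simp only [disjointInteriors_iff, Set.ofPred_exists, Set.ofPred_or]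
  exact isClosed_iUnion_of_finite fun i =>
    (isClosed_ltDir hf hg i).union (isClosed_ltDir hg hf i)

end LittleCube

instance (I : Type) [Finite I] : Finite (TotalOrd I) :=
  Finite.of_injective TotalOrd.lt fun _ _ h => TotalOrd.ext h

theorem TotalOrd.asymm {I : Type} (t : TotalOrd I) {a b : I} (h : t.lt a b) : ¬ t.lt b a :=
  fun h' => t.irrefl _ (t.trans _ _ _ h h')

/-- The total order of a set with at most one element. -/
def TotalOrd.ofSubsingleton (I : Type) [Subsingleton I] : TotalOrd I :=
  ⟨fun _ _ => False, fun _ => id, fun _ _ _ h _ => h, fun _ _ h => (h (Subsingleton.elim _ _)).elim⟩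

instance (I : Type) [Subsingleton I] : Subsingleton (TotalOrd I) :=
  ⟨fun r s => TotalOrd.ext (funext fun a => funext fun b => by
    rw [Subsingleton.elim a b, eq_iff_iff]
    exact iff_of_false (r.irrefl _) (s.irrefl _))⟩

theorem TotalOrd.exists_of_finite (I : Type) [Finite I] : Nonempty (TotalOrd I) := by
  obtain ⟨m, ⟨e⟩⟩ := Finite.exists_equiv_fin I
  exact ⟨⟨fun a b => e a < e b, fun _ => lt_irrefl _, fun _ _ _ => lt_trans,
    fun _ _ h => lt_or_gt_of_ne fun h' => h (e.injective h')⟩⟩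

/-! ### The tensor product operad -/

/-- Two total orders of the members of a family of little cubes agree on all pairs of cubes with
overlapping interiors. -/
def SameOnOverlaps {n : ℕ} {I : Type} (c : I → LittleCube n) (t t' : TotalOrd I) : Prop :=
  ∀ a b, a ≠ b → ¬ (c a).DisjointInteriors (c b) → (t.lt a b ↔ t'.lt a b)

/-- Ordered families of little cubes are identified when they have the same cubes and the orders
agree on overlapping cubes. -/
def orderedCubesSetoid (n : ℕ) (I : Type) : Setoid (TotalOrd I × (I → LittleCube n)) where
  r x y := x.2 = y.2 ∧ SameOnOverlaps x.2 x.1 y.1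
  iseqv :=
    { refl := fun _ => ⟨rfl, fun _ _ _ _ => Iff.rfl⟩
      symm := fun h => ⟨h.1.symm, fun a b hab hd => (h.2 a b hab (h.1 ▸ hd)).symm⟩
      trans := fun h h' => ⟨h.1.trans h'.1, fun a b hab hd =>
        (h.2 a b hab hd).trans (h'.2 a b hab (h.1 ▸ hd))⟩ }

/-- The space of operations of `Ass ⊗ C_n` with inputs labelled by `I`: families of little cubes
together with a total order of the labels, which matters only for overlapping cubes. -/
abbrev OrderedCubes (n : ℕ) (I : Type) : Type := Quotient (orderedCubesSetoid n I)

namespace OrderedCubes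

variable {n : ℕ}

/-- The class of a family of cubes with a total order. -/
abbrev mk {I : Type} (t : TotalOrd I) (c : I → LittleCube n) : OrderedCubes n I :=
  Quotient.mk (orderedCubesSetoid n I) (t, c)

theorem mk_eq_mk {I : Type} {t t' : TotalOrd I} {c c' : I → LittleCube n} :
    mk t c = mk t' c' ↔ c = c' ∧ SameOnOverlaps c t t' := Quotient.eq (r := orderedCubesSetoid n I)

theorem mk_surj {I : Type} (x : OrderedCubes n I) : ∃ t c, mk t c = x := by
  obtain ⟨⟨t, c⟩, rfl⟩ := Quotient.exists_rep x
  exact ⟨t, c, rfl⟩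

/-- The gluing of the finitely many copies of the space of families of cubes takes place along
closed subsets. -/
theorem isClosedMap_mk (I : Type) [Finite I] :
    IsClosedMap (Quotient.mk (orderedCubesSetoid n I)) := by
  intro Z hZ
  rw [← (isQuotientMap_quotient_mk' (s := orderedCubesSetoid n I)).isClosed_preimage]
  -- the saturation of `Z` is the union of the closed sets `S t t'`
  let S : TotalOrd I → TotalOrd I → Set (TotalOrd I × (I → LittleCube n)) := fun t t' =>
    {x | x.1 = t' ∧ (t, x.2) ∈ Z ∧ SameOnOverlaps x.2 t t'}
  have hS : Quotient.mk (orderedCubesSetoid n I) ⁻¹' (Quotient.mk (orderedCubesSetoid n I) '' Z) =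
      ⋃ t, ⋃ t', S t t' := by
    ext ⟨t', c⟩
    simp only [Set.mem_preimage, Set.mem_image, Set.mem_iUnion]
    constructor
    · rintro ⟨⟨t, d⟩, hx, h⟩
      obtain ⟨rfl, h'⟩ := mk_eq_mk.1 h
      exact ⟨t, t', rfl, hx, h'⟩
    · rintro ⟨t, _, rfl, hx, h⟩
      exact ⟨(t, c), hx, mk_eq_mk.2 ⟨rfl, h⟩⟩
  refine hS ▸ isClosed_iUnion_of_finite fun t => isClosed_iUnion_of_finite fun t' => ?_
  refine (isClosed_discrete {t'}).preimage continuous_fst |>.inter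
    ((hZ.preimage (f := fun x : TotalOrd I × (I → LittleCube n) => (t, x.2)) (by fun_prop)).inter ?_)
  change IsClosed {x : TotalOrd I × (I → LittleCube n) | ∀ a b, a ≠ b →
    ¬ (x.2 a).DisjointInteriors (x.2 b) → (t.lt a b ↔ t'.lt a b)}
  simp only [Set.ofPred_forall]
  refine isClosed_iInter fun a => isClosed_iInter fun b => isClosed_iInter fun _ => ?_
  by_cases h : t.lt a b ↔ t'.lt a b
  · simp [h]
  · simp only [h, imp_false, not_not]
    exact LittleCube.isClosed_disjointInteriors ((continuous_apply a).comp continuous_snd)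
      ((continuous_apply b).comp continuous_snd)

theorem isProperMap_mk (I : Type) [Finite I] :
    IsProperMap (Quotient.mk (orderedCubesSetoid n I)) := by
  refine isProperMap_iff_isClosedMap_and_compact_fibers.2
    ⟨continuous_quotient_mk', isClosedMap_mk I, fun y => ?_⟩
  obtain ⟨t, c, rfl⟩ := mk_surj y
  refine ((Set.toFinite (Set.univ (α := TotalOrd I))).prod (Set.finite_singleton c)).subset
    (fun x hx => ?_) |>.isCompact
  exact ⟨trivial, (mk_eq_mk.1 hx).1⟩

instance (I : Type) [Finite I] : CompactlyGeneratedSpace (OrderedCubes n I) := by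
  have : FirstCountableTopology (LittleCube n) := inferInstance
  infer_instance

theorem continuous_mk {I : Type} (t : TotalOrd I) :
    Continuous (mk t : (I → LittleCube n) → OrderedCubes n I) :=
  continuous_quotient_mk'.comp (by fun_prop)

/-- Renaming the labels. -/
def relabel {I J : Type} (e : I ≃ J) : OrderedCubes n I → OrderedCubes n J :=
  Quotient.lift (fun x => mk (x.1.relabel e) (fun j => x.2 (e.symm j))) fun x y h => by
    refine mk_eq_mk.2 ⟨by rw [h.1], fun a b hab hd => ?_⟩
    exact h.2 _ _ (fun h' => hab (e.symm.injective h')) hd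

theorem relabel_mk {I J : Type} (e : I ≃ J) (t : TotalOrd I) (c : I → LittleCube n) :
    relabel e (mk t c) = mk (t.relabel e) (fun j => c (e.symm j)) := rfl

/-- Composition: the little cubes are composed and the orders are combined lexicographically. -/
noncomputable def comp {J : Type} {I : J → Type} (p : OrderedCubes n J)
    (q : ∀ j, OrderedCubes n (I j)) : OrderedCubes n (Σ j, I j) :=
  mk (p.out.1.lex fun j => (q j).out.1) (fun x => (p.out.2 x.1).comp ((q x.1).out.2 x.2))

theorem comp_mk {J : Type} {I : J → Type} (t : TotalOrd J) (c : J → LittleCube n)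
    (s : ∀ j, TotalOrd (I j)) (d : ∀ j, I j → LittleCube n) :
    comp (mk t c) (fun j => mk (s j) (d j)) =
      mk (t.lex s) (fun x => (c x.1).comp (d x.1 x.2)) := by
  obtain ⟨hp, hp'⟩ := Quotient.mk_out (s := orderedCubesSetoid n J) (t, c)
  have hq := fun j => Quotient.mk_out (s := orderedCubesSetoid n (I j)) (s j, d j)
  refine mk_eq_mk.2 ⟨funext fun x => ?_, ?_⟩
  · rw [hp, (hq x.1).1]
  · rintro ⟨j, a⟩ ⟨j', b⟩ hab hd
    dsimp only at hd
    by_cases hj : j = j'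
    · subst hj
      rw [TotalOrd.lex_lt_right, TotalOrd.lex_lt_right]
      exact (hq j).2 a b (fun h => hab (by rw [h]))
        fun h => hd (LittleCube.DisjointInteriors.comp_left _ h)
    · rw [TotalOrd.lex_lt_left _ _ hj, TotalOrd.lex_lt_left _ _ hj]
      exact hp' j j' hj fun h => hd (h.mono _ _)

/-- Since products of proper maps are proper, the map from the product of the spaces of
representatives to the product of the quotients is a quotient map, and continuity can be tested on
representatives. -/
theorem continuous_comp {J : Type} [Finite J] {I : J → Type} [∀ j, Finite (I j)] :
    Continuous (fun x : OrderedCubes n J × (∀ j, OrderedCubes n (I j)) => comp x.1 x.2) := by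
  have hprop := (isProperMap_mk (n := n) J).prodMap
    (IsProperMap.pi_map fun j => isProperMap_mk (n := n) (I j))
  have hsurj := (Quotient.mk_surjective (s := orderedCubesSetoid n J)).prodMap
    (Function.Surjective.piMap fun j => Quotient.mk_surjective (s := orderedCubesSetoid n (I j)))
  refine (hprop.isClosedMap.isQuotientMap hprop.continuous hsurj).continuous_iff.2 ?_
  have hlex : Continuous fun x : (TotalOrd J × (J → LittleCube n)) ×
      (∀ j, TotalOrd (I j) × (I j → LittleCube n)) => x.1.1.lex fun j => (x.2 j).1 :=
    (continuous_of_discreteTopology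
      (f := fun y : TotalOrd J × (∀ j, TotalOrd (I j)) => y.1.lex y.2)).comp
      (g := fun y : TotalOrd J × (∀ j, TotalOrd (I j)) => y.1.lex y.2)
      (f := fun x : (TotalOrd J × (J → LittleCube n)) ×
        (∀ j, TotalOrd (I j) × (I j → LittleCube n)) => (x.1.1, fun j => (x.2 j).1)) (by fun_prop)
  have hcubes : Continuous fun (x : (TotalOrd J × (J → LittleCube n)) ×
      (∀ j, TotalOrd (I j) × (I j → LittleCube n))) (y : Σ j, I j) =>
        (x.1.2 y.1).comp ((x.2 y.1).2 y.2) :=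
    continuous_pi fun y => LittleCube.continuous_comp.comp
      (f := fun x : (TotalOrd J × (J → LittleCube n)) ×
        (∀ j, TotalOrd (I j) × (I j → LittleCube n)) => (x.1.2 y.1, (x.2 y.1).2 y.2)) (by fun_prop)
  exact (continuous_quotient_mk'.comp (hlex.prodMk hcubes)).congr fun x =>
    (comp_mk x.1.1 x.1.2 (fun j => (x.2 j).1) (fun j => (x.2 j).2)).symm

end OrderedCubes

open OrderedCubes in
/-- The tensor product of `Ass` and `C_n`. -/
noncomputable def tensorOperad (n : ℕ) : TopOperad where
  Op I _ := OrderedCubes n I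
  top I _ := inferInstance
  kspace I _ := inferInstance
  relabel e p := relabel e p
  one := mk (TotalOrd.ofSubsingleton Unit) (fun _ => LittleCube.id n)
  comp p q := comp p q
  relabel_refl p := by
    obtain ⟨t, c, rfl⟩ := mk_surj p
    rfl
  relabel_trans e f p := by
    obtain ⟨t, c, rfl⟩ := mk_surj p
    rfl
  comp_relabel_right {J _ I I' _ _} e p q := by
    obtain ⟨t, c, rfl⟩ := mk_surj p
    choose s d h using fun j => mk_surj (q j)
    obtain rfl : (fun j => mk (s j) (d j)) = q := funext h
    simp only [relabel_mk, comp_mk]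
    exact congrArg₂ mk (assOperad.comp_relabel_right e t s) rfl
  comp_relabel_left {J J' _ _ I _} e p q := by
    obtain ⟨t, c, rfl⟩ := mk_surj p
    choose s d h using fun j => mk_surj (q j)
    obtain rfl : (fun j => mk (s j) (d j)) = q := funext h
    simp only [relabel_mk, comp_mk]
    refine congrArg₂ mk (assOperad.comp_relabel_left e t s) (funext fun x => ?_)
    obtain ⟨⟨j, a⟩, rfl⟩ := (Equiv.sigmaCongrLeft (β := I) e).surjective x
    rw [Equiv.symm_apply_apply]
    simp [Equiv.sigmaCongrLeft]
  one_comp p := by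
    obtain ⟨t, c, rfl⟩ := mk_surj p
    simp only [relabel_mk, comp_mk]
    exact congrArg₂ mk (assOperad.one_comp t) (funext fun x => LittleCube.id_comp _)
  comp_one p := by
    obtain ⟨t, c, rfl⟩ := mk_surj p
    simp only [relabel_mk, comp_mk]
    exact congrArg₂ mk (assOperad.comp_one t) (funext fun x => LittleCube.comp_id _)
  comp_assoc {J _ I _ L _} p q r := by
    obtain ⟨t, c, rfl⟩ := mk_surj p
    choose s d h using fun j => mk_surj (q j)
    obtain rfl : (fun j => mk (s j) (d j)) = q := funext h
    choose u e h' using fun j i => mk_surj (r j i)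
    obtain rfl : (fun j i => mk (u j i) (e j i)) = r := funext fun j => funext (h' j)
    rw [comp_mk, comp_mk (t.lex s) _ (fun x => u x.1 x.2) (fun x => e x.1 x.2)]
    simp only [relabel_mk, comp_mk]
    exact congrArg₂ mk (assOperad.comp_assoc t s u) (funext fun x => LittleCube.comp_assoc _ _ _)
  continuous_relabel {I J _ _} e := by
    refine (isQuotientMap_quotient_mk' (s := orderedCubesSetoid n I)).continuous_iff.2 ?_
    refine continuous_quotient_mk'.comp (Continuous.prodMk ?_ (by fun_prop))
    exact (continuous_of_discreteTopology (f := TotalOrd.relabel e)).comp continuous_fst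
  continuous_comp p q hp hq :=
    OrderedCubes.continuous_comp.comp (hp.prodMk (continuous_pi hq))

namespace tensorOperad

variable (n : ℕ)

theorem relabel_mk {n : ℕ} {I J : Type} [Finite I] [Finite J] (e : I ≃ J) (t : TotalOrd I)
    (c : I → LittleCube n) : (tensorOperad n).relabel e (OrderedCubes.mk t c) =
      OrderedCubes.mk (t.relabel e) (fun j => c (e.symm j)) := rfl

theorem comp_mk {n : ℕ} {J : Type} [Finite J] {I : J → Type} [∀ j, Finite (I j)]
    (t : TotalOrd J) (c : J → LittleCube n)
    (s : ∀ j, TotalOrd (I j)) (d : ∀ j, I j → LittleCube n) :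
    (tensorOperad n).comp (OrderedCubes.mk t c) (fun j => OrderedCubes.mk (s j) (d j)) =
      OrderedCubes.mk (t.lex s) (fun x => (c x.1).comp (d x.1 x.2)) :=
  OrderedCubes.comp_mk t c s d

/-- The map `Ass → Ass ⊗ C_n`. -/
noncomputable def ofAss : TopOperad.Hom assOperad (tensorOperad n) where
  toFun {I} _ t := OrderedCubes.mk t fun _ => LittleCube.id n
  continuous_toFun _ _ := continuous_of_discreteTopology (α := TotalOrd _)
  map_relabel _ _ := rfl
  map_one := rfl
  map_comp {J _ I _} p q := by
    refine Eq.trans ?_ (comp_mk (I := I) p (fun _ => LittleCube.id n) q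
      (fun _ _ => LittleCube.id n)).symm
    exact congrArg₂ OrderedCubes.mk rfl (funext fun _ => (LittleCube.id_comp _).symm)

/-- For cubes with pairwise disjoint interiors the order does not matter. -/
theorem mk_eq_of_pairwise {n : ℕ} {I : Type} (t t' : TotalOrd I) (c : LittleCubes n I) :
    OrderedCubes.mk t c.1 = OrderedCubes.mk t' c.1 :=
  OrderedCubes.mk_eq_mk.2 ⟨rfl, fun _ _ hab hd => absurd (c.2 hab) hd⟩

/-- The map `C_n → Ass ⊗ C_n`; the choice of a total order does not matter, as the cubes have
pairwise disjoint interiors. -/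
noncomputable def ofCubes : TopOperad.Hom (cubesOperad n) (tensorOperad n) where
  toFun {I} _ c := OrderedCubes.mk (TotalOrd.exists_of_finite I).some c.1
  continuous_toFun I _ := (OrderedCubes.continuous_mk _).comp continuous_subtype_val
  map_relabel e p := by
    rw [relabel_mk]
    exact mk_eq_of_pairwise _ _ ((cubesOperad n).relabel e p)
  map_one := mk_eq_of_pairwise _ _ (cubesOperad n).one
  map_comp p q := by
    rw [comp_mk]
    exact mk_eq_of_pairwise _ _ ((cubesOperad n).comp p q)

variable {n}

theorem ofCubes_apply {I : Type} [Finite I] (t : TotalOrd I) (c : LittleCubes n I) :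
    (ofCubes n).toFun c = OrderedCubes.mk t c.1 := mk_eq_of_pairwise _ _ c

theorem interchange : TopOperad.Interchange (ofAss n) (ofCubes n) := by
  intro I J _ _ (a : TotalOrd I) (b : LittleCubes n J)
  obtain ⟨t⟩ := TotalOrd.exists_of_finite J
  rw [ofCubes_apply t b]
  refine (congrArg ((tensorOperad n).relabel (swapEquiv I J)) (comp_mk a
    (fun _ => LittleCube.id n) (fun _ => t) (fun _ => b.1))).trans
    (Eq.trans ?_ (comp_mk t b.1 (fun _ => a) (fun _ _ => LittleCube.id n)).symm)
  rw [relabel_mk]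
  refine OrderedCubes.mk_eq_mk.2 ⟨funext fun x => ?_, ?_⟩
  · exact (LittleCube.id_comp _).trans (LittleCube.comp_id _).symm
  · rintro ⟨j, x⟩ ⟨j', y⟩ hne hd
    by_cases hj : j = j'
    · subst hj
      have hxy : x ≠ y := fun h => hne (by rw [h])
      rw [TotalOrd.lex_lt_right]
      exact TotalOrd.lex_lt_left _ _ hxy _ _
    · refine absurd ?_ hd
      exact (b.2 hj).comp_left _

/-- Every operation of `Ass ⊗ C_n` is a product of unary operations. -/
theorem orderedProduct_eq {I : Type} [Finite I] (t : TotalOrd I) (c : I → LittleCube n) :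
    orderedProduct (ofAss n) (ofCubes n) t c = OrderedCubes.mk t c := by
  refine (congrArg ((tensorOperad n).relabel (Equiv.sigmaPUnit I)) (comp_mk t
    (fun _ => LittleCube.id n) (fun _ => (TotalOrd.exists_of_finite Unit).some)
    (fun p _ => c p))).trans ?_
  rw [relabel_mk]
  refine OrderedCubes.mk_eq_mk.2 ⟨funext fun x => LittleCube.id_comp _, ?_⟩
  rintro x y hne -
  exact TotalOrd.lex_lt_left _ _ hne _ _

end tensorOperad

/-! ### Operad algebra of an interchanging pair -/

/-- The equivalence exchanging the two indices of a family with two indices. -/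
def sigmaSwap {I J : Type} (L : I → J → Type) : (Σ i, Σ j, L i j) ≃ (Σ j, Σ i, L i j) where
  toFun x := ⟨x.2.1, x.1, x.2.2⟩
  invFun x := ⟨x.2.1, x.1, x.2.2⟩
  left_inv _ := rfl
  right_inv _ := rfl

namespace TopOperad

theorem relabel_congr (D : TopOperad) {I J : Type} [Finite I] [Finite J] {e e' : I ≃ J}
    (h : ∀ x, e x = e' x) (p : D.Op I) : D.relabel e p = D.relabel e' p := by
  rw [Equiv.ext h]

theorem relabel_injective (D : TopOperad) {I J : Type} [Finite I] [Finite J] (e : I ≃ J) :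
    Function.Injective (D.relabel e) := by
  refine Function.LeftInverse.injective (g := D.relabel e.symm) fun p => ?_
  rw [← D.relabel_trans, Equiv.self_trans_symm, D.relabel_refl]

/-- Plugging nothing into a nullary operation only renames its empty set of inputs. -/
theorem comp_of_isEmpty (D : TopOperad) {J : Type} [Finite J] [IsEmpty J] {I : J → Type}
    [∀ j, Finite (I j)] (p : D.Op J) (q : ∀ j, D.Op (I j)) :
    D.comp p q = D.relabel (Equiv.equivOfIsEmpty J (Σ j, I j)) p := by
  have hq : q = fun j => D.relabel (I := Unit) (isEmptyElim j) D.one := funext fun j => isEmptyElim j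
  rw [hq, D.comp_relabel_right]
  conv_rhs => rw [← D.comp_one p, ← D.relabel_trans]
  exact D.relabel_congr (fun x => isEmptyElim x.1) _

/-- The interchange relation with arbitrary operations plugged into the inputs. -/
theorem Interchange.comp_comp {A B D : TopOperad} {f : Hom A D} {g : Hom B D}
    (h : Interchange f g) {I J : Type} [Finite I] [Finite J] (a : A.Op I) (b : B.Op J)
    {L : I → J → Type} [∀ i j, Finite (L i j)] (r : ∀ i j, D.Op (L i j)) :
    D.relabel (sigmaSwap L) (D.comp (f.toFun a) (fun i => D.comp (g.toFun b) (r i))) =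
      D.comp (g.toFun b) (fun j => D.comp (f.toFun a) (fun i => r i j)) := by
  have key := congrArg (fun w => D.comp w (fun x : Σ _ : J, I => r x.2 x.1)) (h I J a b)
  rw [D.comp_relabel_left (I := fun x : Σ _ : J, I => L x.2 x.1)] at key
  rw [← D.comp_assoc (I := fun _ => J) (L := L), ← D.comp_assoc (I := fun _ => I)
    (L := fun j i => L i j), ← key, ← D.relabel_trans, ← D.relabel_trans]
  exact D.relabel_congr (fun x => rfl) _

end TopOperad

section Algebra

variable {n : ℕ} {D : TopOperad} {f : Hom assOperad D} {g : Hom (cubesOperad n) D}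

/-- The family of identity cubes on a set with at most one element. -/
def LittleCubes.ofSubsingleton (n : ℕ) (S : Type) [Subsingleton S] : LittleCubes n S :=
  ⟨fun _ => LittleCube.id n, fun _ _ h => (h (Subsingleton.elim _ _)).elim⟩

/-- The units of `Ass` and of `C_n` agree: for a nonempty set of inputs both are the identity
operation, and the two nullary operations agree by interchange. -/
theorem TopOperad.Interchange.unit_eq (h : Interchange f g) (S : Type) [Finite S]
    [Subsingleton S] (t : TotalOrd S) :
    f.toFun t = g.toFun (LittleCubes.ofSubsingleton n S) := by
  rcases isEmpty_or_nonempty S with hS | ⟨⟨s⟩⟩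
  · have key := h S S t (LittleCubes.ofSubsingleton n S)
    rw [D.comp_of_isEmpty, D.comp_of_isEmpty, ← D.relabel_trans] at key
    refine D.relabel_injective (Equiv.equivOfIsEmpty S (Σ _ : S, S)) (Eq.trans ?_ key)
    exact D.relabel_congr (fun x => isEmptyElim x) _
  · let e : Unit ≃ S := ⟨fun _ => s, fun _ => (), fun _ => rfl, fun _ => Subsingleton.elim _ _⟩
    have h1 : t = assOperad.relabel e assOperad.one := Subsingleton.elim (α := TotalOrd S) _ _
    have h2 : LittleCubes.ofSubsingleton n S = (cubesOperad n).relabel e (cubesOperad n).one := rfl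
    rw [h1, h2, f.map_relabel, g.map_relabel, f.map_one, g.map_one]

theorem orderedProduct_relabel {I J : Type} [Finite I] [Finite J] (e : I ≃ J) (t : TotalOrd I)
    (c : J → LittleCube n) :
    orderedProduct f g (t.relabel e) c = D.relabel e (orderedProduct f g t fun i => c (e i)) := by
  have h := f.map_relabel e t
  unfold orderedProduct
  rw [show f.toFun (t.relabel e) = D.relabel e (f.toFun t) from h, D.comp_relabel_left,
    ← D.relabel_trans, ← D.relabel_trans]
  exact D.relabel_congr (fun x => rfl) _

/-- An ordered product along a lexicographic order is an iterated ordered product. -/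
theorem orderedProduct_lex {J : Type} [Finite J] {I : J → Type} [∀ j, Finite (I j)]
    (r : TotalOrd J) (s : ∀ j, TotalOrd (I j)) (c : (Σ j, I j) → LittleCube n) :
    orderedProduct f g (r.lex s) c =
      D.comp (f.toFun (I := J) r) (fun j => orderedProduct f g (s j) fun i => c ⟨j, i⟩) := by
  have h : f.toFun (I := Σ j, I j) (r.lex s) =
    D.comp (f.toFun (I := J) r) (fun j => f.toFun (I := I j) (s j)) := f.map_comp r s
  unfold orderedProduct
  rw [h, D.comp_relabel_right, ← D.comp_assoc (L := fun j (i : I j) => Unit), ← D.relabel_trans]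
  exact D.relabel_congr (fun x => rfl) _

/-- A little cube distributes over ordered products. -/
theorem TopOperad.Interchange.unary_comp_orderedProduct (h : Interchange f g) {I : Type}
    [Finite I] (t : TotalOrd I) (c : LittleCube n) (d : I → LittleCube n) :
    D.relabel (leftUnitEquiv I) (D.comp (g.toFun c.unary) fun _ => orderedProduct f g t d) =
      orderedProduct f g t fun i => c.comp (d i) := by
  have key := h.comp_comp (I := I) t c.unary (L := fun _ _ => Unit) fun i _ => g.toFun (d i).unary
  have hc : ∀ i, D.comp (g.toFun c.unary) (fun _ => g.toFun (d i).unary) =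
      D.relabel (leftUnitEquiv Unit).symm (g.toFun (c.comp (d i)).unary) := fun i => by
    rw [← g.map_comp, ← g.map_relabel]
    rfl
  simp only [hc] at key
  unfold orderedProduct
  rw [D.comp_relabel_right, ← key, D.comp_relabel_right, ← D.relabel_trans, ← D.relabel_trans,
    ← D.relabel_trans]
  exact D.relabel_congr (fun x => rfl) _

/-- A family of cubes with pairwise disjoint interiors is the product, in any order, of its
members. The proof plugs units off the diagonal into the interchange relation. -/
theorem TopOperad.Interchange.orderedProduct_of_pairwise (h : Interchange f g) {I : Type}
    [Finite I] (t : TotalOrd I) (c : LittleCubes n I) :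
    orderedProduct f g t c.1 = g.toFun c := by
  have key := h.comp_comp (I := I) (J := I) t c (L := fun i j => PLift (i = j)) fun i j =>
    f.toFun (TotalOrd.ofSubsingleton (PLift (i = j)))
  let e₁ : ∀ i : I, Unit ≃ Σ j, PLift (i = j) := fun i =>
    ⟨fun _ => ⟨i, ⟨rfl⟩⟩, fun _ => (), fun _ => rfl, by rintro ⟨_, ⟨rfl⟩⟩; rfl⟩
  let e₂ : ∀ j : I, Unit ≃ Σ i, PLift (i = j) := fun j =>
    ⟨fun _ => ⟨j, ⟨rfl⟩⟩, fun _ => (), fun _ => rfl, by rintro ⟨_, ⟨rfl⟩⟩; rfl⟩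
  have h1 : ∀ i, D.comp (g.toFun c)
      (fun j => f.toFun (TotalOrd.ofSubsingleton (PLift (i = j)))) =
      D.relabel (e₁ i) (g.toFun (c.1 i).unary) := fun i => by
    simp only [h.unit_eq]
    refine (g.map_comp (I := fun j => PLift (i = j)) c
      fun j => LittleCubes.ofSubsingleton n (PLift (i = j))).symm.trans
      (Eq.trans (congrArg g.toFun (Subtype.ext (funext ?_))) (g.map_relabel (e₁ i) (c.1 i).unary))
    rintro ⟨_, ⟨rfl⟩⟩
    exact LittleCube.comp_id _
  have h2 : ∀ j, D.comp (f.toFun (I := I) t)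
      (fun i => f.toFun (TotalOrd.ofSubsingleton (PLift (i = j)))) =
      D.relabel (e₂ j) D.one := fun j => by
    refine (f.map_comp (I := fun i => PLift (i = j)) t
      fun i => TotalOrd.ofSubsingleton (PLift (i = j))).symm.trans ?_
    rw [← f.map_one, ← f.map_relabel]
    have : Subsingleton (Σ i, PLift (i = j)) := (e₂ j).symm.subsingleton
    exact congrArg f.toFun (Subsingleton.elim (α := TotalOrd (Σ i, PLift (i = j))) _ _)
  simp only [h1, h2] at key
  rw [D.comp_relabel_right, D.comp_relabel_right, ← D.relabel_trans] at key
  have hc := D.comp_one (g.toFun c)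
  refine D.relabel_injective ((Equiv.sigmaPUnit I).symm.trans (Equiv.sigmaCongrRight e₂)) ?_
  rw [← hc, ← D.relabel_trans]
  unfold orderedProduct
  rw [← D.relabel_trans]
  refine Eq.trans ?_ (key.trans ?_)
  · refine D.relabel_congr (fun x => ?_) _
    rfl
  · refine D.relabel_congr (fun x => ?_) _
    rfl

/-- The order of a subset. -/
def TotalOrd.comap {I J : Type} (e : I ↪ J) (t : TotalOrd J) : TotalOrd I where
  lt a b := t.lt (e a) (e b)
  irrefl _ := t.irrefl _
  trans _ _ _ := t.trans _ _ _
  total _ _ h := t.total _ _ (fun h' => h (e.injective h'))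

/-- An ordered product depends only on the order of the fibres of a map `π` compatible with the
orders, if the cubes in each fibre have pairwise disjoint interiors. -/
theorem TopOperad.Interchange.orderedProduct_of_fibres (h : Interchange f g) {I J : Type}
    [Finite I] [Finite J] (π : I → J) (r : TotalOrd J) (t : TotalOrd I) (c : I → LittleCube n)
    (ht : ∀ x y, π x ≠ π y → (t.lt x y ↔ r.lt (π x) (π y)))
    (hc : ∀ j, Pairwise fun x y : {x // π x = j} => (c x).DisjointInteriors (c y)) :
    orderedProduct f g t c = D.relabel (Equiv.sigmaFiberEquiv π) (D.comp (f.toFun (I := J) r)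
      fun j => g.toFun (I := {x // π x = j}) (⟨fun x => c x, hc j⟩ : LittleCubes n {x // π x = j})) := by
  have hlex : t = (r.lex fun j => t.comap (Function.Embedding.subtype fun x => π x = j)).relabel
      (Equiv.sigmaFiberEquiv π) := by
    refine TotalOrd.ext_of_relabel (Equiv.sigmaFiberEquiv π) ?_
    rintro ⟨j, x, hx⟩ ⟨j', y, hy⟩
    rw [TotalOrd.relabel_lt]
    by_cases hj : j = j'
    · subst hj
      rw [TotalOrd.lex_lt_right]
      rfl
    · rw [TotalOrd.lex_lt_left _ _ hj]
      subst hx hy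
      exact ht x y hj
  rw [hlex, orderedProduct_relabel, orderedProduct_lex]
  congr 2
  funext j
  exact h.orderedProduct_of_pairwise _ (⟨fun x => c x, hc j⟩ : LittleCubes n {x // π x = j})

end Algebra

/-! ### Sorting an ordered product -/

namespace TotalOrd

variable {I : Type}

/-- Exchange two elements `p < q` that are adjacent in a total order. -/
def swapAdjacent (t : TotalOrd I) {p q : I} (hpq : t.lt p q)
    (hadj : ∀ z, t.lt p z → ¬ t.lt z q) : TotalOrd I where
  lt a b := (t.lt a b ∧ ¬ (a = p ∧ b = q)) ∨ (a = q ∧ b = p)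
  irrefl a := by
    have := t.irrefl a
    have := t.irrefl p
    grind
  trans a b c := by
    have h0 := t.irrefl
    have h1 := t.trans
    have h2 := t.total
    grind
  total a b h := by
    have := t.total a b h
    grind

/-- Two different total orders of a finite set differ on an adjacent pair. -/
theorem exists_adjacent_inversion [Finite I] {t t' : TotalOrd I} (h : t ≠ t') :
    ∃ p q, t.lt p q ∧ t'.lt q p ∧ ∀ z, t.lt p z → ¬ t.lt z q := by
  let S : Set (I × I) := {x | t.lt x.1 x.2 ∧ t'.lt x.2 x.1}
  have hS : S.Nonempty := by
    by_contra hS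
    have key : ∀ a b, t.lt a b → t'.lt a b := fun a b hab => by
      by_contra hab'
      have hne : a ≠ b := fun e => t.irrefl b (e ▸ hab)
      exact hS ⟨(a, b), hab, (t'.total a b hne).resolve_left hab'⟩
    refine h (TotalOrd.ext (funext fun a => funext fun b => eq_iff_iff.2 ⟨key a b, fun hab => ?_⟩))
    have hne : a ≠ b := fun e => t'.irrefl b (e ▸ hab)
    exact (t.total a b hne).resolve_right fun hba => t'.asymm hab (key b a hba)
  -- an inverted pair with the least number of elements in between is adjacent
  obtain ⟨⟨p, q⟩, ⟨hpq, hqp⟩, hmin⟩ := Set.exists_min_image S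
    (fun x => {z | t.lt x.1 z ∧ t.lt z x.2}.ncard) (Set.toFinite _) hS
  refine ⟨p, q, hpq, hqp, fun z hpz hzq => ?_⟩
  dsimp only at hmin hpq hqp
  by_cases hz : t'.lt z p
  · refine absurd (hmin (p, z) ⟨hpz, hz⟩) (not_le.2 (Set.ncard_lt_ncard ?_ (Set.toFinite _)))
    refine ⟨fun w hw => ⟨hw.1, t.trans _ _ _ hw.2 hzq⟩, fun hsub => ?_⟩
    exact t.irrefl z (hsub (show z ∈ _ from ⟨hpz, hzq⟩)).2
  · have hz' : t'.lt q z := by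
      by_cases hzp : z = p
      · exact hzp ▸ hqp
      · exact t'.trans _ _ _ hqp ((t'.total z p hzp).resolve_left hz)
    refine absurd (hmin (z, q) ⟨hzq, hz'⟩) (not_le.2 (Set.ncard_lt_ncard ?_ (Set.toFinite _)))
    refine ⟨fun w hw => ⟨t.trans _ _ _ hpz hw.1, hw.2⟩, fun hsub => ?_⟩
    exact t.irrefl z (hsub (show z ∈ _ from ⟨hpz, hzq⟩)).1

end TotalOrd

section Universal

variable {n : ℕ} {D : TopOperad} {f : Hom assOperad D} {g : Hom (cubesOperad n) D}

/-- Cubes with disjoint interiors that are adjacent in the order may be exchanged. -/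
theorem TopOperad.Interchange.orderedProduct_swapAdjacent (h : Interchange f g) {I : Type}
    [Finite I] (t : TotalOrd I) (c : I → LittleCube n) {p q : I} (hpq : t.lt p q)
    (hadj : ∀ z, t.lt p z → ¬ t.lt z q) (hc : (c p).DisjointInteriors (c q)) :
    orderedProduct f g t c = orderedProduct f g (t.swapAdjacent hpq hadj) c := by
  classical
  -- the map that moves `q` to `p` is compatible with both orders
  let π : I → I := fun x => if x = q then p else x
  have hfib : ∀ j, Pairwise fun x y : {x // π x = j} => (c x).DisjointInteriors (c y) := by
    rintro j ⟨x, hx⟩ ⟨y, hy⟩ hxy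
    have hxy' : x ≠ y := fun e => hxy (Subtype.ext e)
    have hcases : (x = p ∧ y = q) ∨ (x = q ∧ y = p) := by grind
    rcases hcases with ⟨rfl, rfl⟩ | ⟨rfl, rfl⟩
    · exact hc
    · exact hc.symm
  have h0 := t.irrefl
  have h1 := t.trans
  have h2 := t.total
  rw [h.orderedProduct_of_fibres π t t c (fun x y hxy => by grind) hfib,
    h.orderedProduct_of_fibres π t (t.swapAdjacent hpq hadj) c (fun x y hxy => by
      simp only [TotalOrd.swapAdjacent]
      grind) hfib]

/-- The ordered product depends on the order only through its restriction to overlapping cubes: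
sort by exchanging adjacent cubes. -/
theorem TopOperad.Interchange.orderedProduct_congr (h : Interchange f g) {I : Type} [Finite I]
    (c : I → LittleCube n) (t t' : TotalOrd I) (hs : SameOnOverlaps c t t') :
    orderedProduct f g t c = orderedProduct f g t' c := by
  by_cases htt : t = t'
  · rw [htt]
  obtain ⟨p, q, hpq, hqp, hadj⟩ := TotalOrd.exists_adjacent_inversion htt
  have hne : p ≠ q := fun e => t.irrefl q (e ▸ hpq)
  have hc : (c p).DisjointInteriors (c q) := by
    by_contra hc
    exact t'.asymm hqp ((hs p q hne hc).1 hpq)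
  have hdec : {x : I × I | (t.swapAdjacent hpq hadj).lt x.1 x.2 ∧ t'.lt x.2 x.1}.ncard <
      {x : I × I | t.lt x.1 x.2 ∧ t'.lt x.2 x.1}.ncard := by
    refine Set.ncard_lt_ncard ⟨?_, fun hsub => ?_⟩ (Set.toFinite _)
    · rintro ⟨a, b⟩ ⟨⟨hab, -⟩ | ⟨rfl, rfl⟩, hba⟩
      · exact ⟨hab, hba⟩
      · exact absurd hba (t'.asymm hqp)
    · rcases (hsub (show (p, q) ∈ _ from ⟨hpq, hqp⟩)).1 with ⟨_, hn⟩ | ⟨e, _⟩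
      · exact hn ⟨rfl, rfl⟩
      · exact hne e
  rw [h.orderedProduct_swapAdjacent t c hpq hadj hc]
  refine h.orderedProduct_congr c _ t' fun a b hab hd => ?_
  have hab' : ¬ (a = p ∧ b = q) := fun e => hd (e.1 ▸ e.2 ▸ hc)
  have hab'' : ¬ (a = q ∧ b = p) := fun e => hd (e.1 ▸ e.2 ▸ hc.symm)
  rw [← hs a b hab hd]
  simp only [TotalOrd.swapAdjacent]
  tauto
termination_by {x : I × I | t.lt x.1 x.2 ∧ t'.lt x.2 x.1}.ncard

/-! ### The universal property -/

theorem LittleCube.continuous_unary : Continuous (LittleCube.unary : LittleCube n → _) :=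
  Continuous.subtype_mk (continuous_pi fun _ => continuous_id) _

theorem continuous_orderedProduct (f : Hom assOperad D) (g : Hom (cubesOperad n) D) {I : Type}
    [Finite I] (t : TotalOrd I) :
    Continuous (orderedProduct f g t : (I → LittleCube n) → D.Op I) := by
  have : FirstCountableTopology (LittleCube n) := inferInstance
  refine continuous_from_compactlyGeneratedSpace _ fun K _ _ _ φ hφ => ?_
  refine (D.continuous_relabel _).comp (D.continuous_comp _ _ continuous_const fun p => ?_)
  exact (g.continuous_toFun Unit).comp (LittleCube.continuous_unary.comp
    ((continuous_apply p).comp hφ))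

/-- The map out of `Ass ⊗ C_n` induced by an interchanging pair. -/
noncomputable def TopOperad.Interchange.desc (h : Interchange f g) : Hom (tensorOperad n) D where
  toFun {I} _ := Quotient.lift (s := orderedCubesSetoid n I)
    (fun x => orderedProduct f g x.1 x.2) (fun x y hxy => by
      have h1 := hxy.1
      have h2 := h.orderedProduct_congr x.2 x.1 y.1 hxy.2
      rw [h2, h1])
  continuous_toFun I _ := by
    refine (isQuotientMap_quotient_mk' (s := orderedCubesSetoid n I)).continuous_iff.2 ?_
    exact continuous_prod_of_discrete_left.2 fun t => continuous_orderedProduct f g t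
  map_relabel {I J _ _} e p := by
    obtain ⟨t, c, rfl⟩ := OrderedCubes.mk_surj p
    refine (orderedProduct_relabel e t fun j => c (e.symm j)).trans ?_
    simp only [Equiv.symm_apply_apply]
    rfl
  map_one := (h.orderedProduct_of_pairwise (TotalOrd.ofSubsingleton Unit)
    (LittleCubes.ofSubsingleton n Unit)).trans g.map_one
  map_comp {J _ I _} p q := by
    obtain ⟨t, c, rfl⟩ := OrderedCubes.mk_surj p
    choose s d hq using fun j => OrderedCubes.mk_surj (q j)
    obtain rfl : (fun j => OrderedCubes.mk (s j) (d j)) = q := funext hq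
    rw [tensorOperad.comp_mk]
    change orderedProduct f g (t.lex s) _ = D.comp (orderedProduct f g t c)
      (fun j => orderedProduct f g (s j) (d j))
    rw [orderedProduct_lex]
    simp only [← h.unary_comp_orderedProduct]
    rw [D.comp_relabel_right, ← D.comp_assoc (I := fun _ => Unit) (L := fun j _ => I j)
      (f.toFun (I := J) t) (fun j => g.toFun (c j).unary) (fun j _ => orderedProduct f g (s j) (d j))]
    unfold orderedProduct
    rw [D.comp_relabel_left, ← D.relabel_trans]
    exact D.relabel_congr (fun x => rfl) _

theorem TopOperad.Interchange.desc_mk (h : Interchange f g) {I : Type} [Finite I]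
    (t : TotalOrd I) (c : I → LittleCube n) :
    h.desc.toFun (OrderedCubes.mk t c : OrderedCubes n I) = orderedProduct f g t c := rfl

theorem TopOperad.Hom.ext {A B : TopOperad} {f g : Hom A B}
    (h : ∀ (I : Type) [Finite I] (p : A.Op I), f.toFun p = g.toFun p) : f = g := by
  cases f
  cases g
  congr
  funext I _ p
  exact h I p

theorem TopOperad.Hom.map_orderedProduct {P : TopOperad} (f : Hom assOperad P)
    (g : Hom (cubesOperad n) P) (φ : Hom P D) {I : Type} [Finite I] (t : TotalOrd I)
    (c : I → LittleCube n) :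
    φ.toFun (orderedProduct f g t c) = orderedProduct (φ.comp f) (φ.comp g) t c := by
  unfold orderedProduct
  rw [φ.map_relabel, φ.map_comp]
  rfl

theorem tensorOperad.isTensorProduct (n : ℕ) :
    IsTensorProduct (tensorOperad.ofAss n) (tensorOperad.ofCubes n) where
  interchange := tensorOperad.interchange
  universal D f g h := by
    refine ⟨h.desc, ⟨Hom.ext fun I _ t => ?_, Hom.ext fun I _ c => ?_⟩, ?_⟩
    · change orderedProduct f g t (fun _ => LittleCube.id n) = _
      have h1 : g.toFun (LittleCube.unary (LittleCube.id n)) = D.one := g.map_one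
      have h2 : (fun _ : I => g.toFun (LittleCube.unary (LittleCube.id n))) = fun _ => D.one :=
        funext fun _ => h1
      exact (congrArg (fun q => D.relabel (Equiv.sigmaPUnit I) (D.comp (f.toFun t) q)) h2).trans
        (D.comp_one _)
    · exact h.orderedProduct_of_pairwise _ c
    · rintro φ ⟨rfl, rfl⟩
      refine Hom.ext fun I _ p => ?_
      obtain ⟨t, c, rfl⟩ := OrderedCubes.mk_surj p
      rw [h.desc_mk, ← Hom.map_orderedProduct, tensorOperad.orderedProduct_eq]

end Universal

/-! ### Ordered products in an arbitrary tensor product -/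

namespace TopOperad.IsTensorProduct

variable {n : ℕ} {P : TopOperad} {i : Hom assOperad P} {j : Hom (cubesOperad n) P}

/-- Tensor products are unique up to isomorphism. -/
theorem exists_iso (hP : IsTensorProduct i j) : ∃ (φ : Hom (tensorOperad n) P)
    (ψ : Hom P (tensorOperad n)), (φ.comp (tensorOperad.ofAss n) = i ∧
      φ.comp (tensorOperad.ofCubes n) = j) ∧
      (∀ (I : Type) [Finite I] (p : (tensorOperad n).Op I), ψ.toFun (φ.toFun p) = p) ∧
      ∀ (I : Type) [Finite I] (p : P.Op I), φ.toFun (ψ.toFun p) = p := by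
  have hQ := tensorOperad.isTensorProduct n
  obtain ⟨φ, ⟨h1, h2⟩, -⟩ := hQ.universal P i j hP.interchange
  obtain ⟨ψ, ⟨h3, h4⟩, -⟩ := hP.universal _ _ _ hQ.interchange
  let id' : ∀ A : TopOperad, Hom A A := fun A =>
    ⟨fun p => p, fun _ _ => continuous_id, fun _ _ => rfl, rfl, fun _ _ => rfl⟩
  have hc : ∀ {A B C E : TopOperad} (u : Hom C E) (v : Hom B C) (w : Hom A B),
    (u.comp v).comp w = u.comp (v.comp w) := fun _ _ _ => rfl
  have h5 : ψ.comp φ = id' _ := (hQ.universal _ _ _ hQ.interchange).unique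
    ⟨by rw [hc, h1, h3], by rw [hc, h2, h4]⟩ ⟨rfl, rfl⟩
  have h6 : φ.comp ψ = id' _ := (hP.universal _ _ _ hP.interchange).unique
    ⟨by rw [hc, h3, h1], by rw [hc, h4, h2]⟩ ⟨rfl, rfl⟩
  refine ⟨φ, ψ, ⟨h1, h2⟩, fun I _ p => ?_, fun I _ p => ?_⟩
  · exact congrArg (fun u : Hom (tensorOperad n) (tensorOperad n) => u.toFun p) h5
  · exact congrArg (fun u : Hom P P => u.toFun p) h6

theorem orderedProduct_eq_iff (hP : IsTensorProduct i j) {I : Type} [Finite I]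
    {t t' : TotalOrd I} {c c' : I → LittleCube n} :
    orderedProduct i j t c = orderedProduct i j t' c' ↔ c = c' ∧ SameOnOverlaps c t t' := by
  obtain ⟨φ, ψ, ⟨rfl, rfl⟩, hψ, -⟩ := hP.exists_iso
  rw [← Hom.map_orderedProduct, ← Hom.map_orderedProduct, tensorOperad.orderedProduct_eq,
    tensorOperad.orderedProduct_eq, ← OrderedCubes.mk_eq_mk]
  exact ⟨fun h => (hψ I _).symm.trans ((congrArg ψ.toFun h).trans (hψ I _)),
    fun h => congrArg φ.toFun h⟩

theorem isQuotientMap_orderedProduct (hP : IsTensorProduct i j) (I : Type) [Finite I] :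
    Topology.IsQuotientMap (fun x : TotalOrd I × (I → LittleCube n) =>
      orderedProduct i j x.1 x.2) := by
  obtain ⟨φ, ψ, ⟨rfl, rfl⟩, hψ, hφ⟩ := hP.exists_iso
  let e : (tensorOperad n).Op I ≃ₜ P.Op I :=
    ⟨⟨φ.toFun, ψ.toFun, hψ I, hφ I⟩, φ.continuous_toFun I, ψ.continuous_toFun I⟩
  have h := e.isQuotientMap.comp (isQuotientMap_quotient_mk' (s := orderedCubesSetoid n I))
  refine (congrArg Topology.IsQuotientMap (funext fun x => ?_)).mp h
  rw [← Hom.map_orderedProduct, tensorOperad.orderedProduct_eq]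
  rfl

end TopOperad.IsTensorProduct

/-! ### Graphs of total orders -/

section Graphs

variable {n k : ℕ}

/-- The total order `t` extends the orientation of `l`. -/
def KHat.ExtendedBy (l : KHat 1 k) (t : TotalOrd (Fin k)) : Prop :=
  ∀ a b h, l.1.edge a b = some h → t.lt a b

open Classical in
/-- The graph in which the edges between the pairs related by `R` are coloured, with orientation
given by a total order. -/
noncomputable def TotalOrd.graph (t : TotalOrd (Fin k)) (R : Fin k → Fin k → Prop) : KHat 1 k :=
  ⟨{ edge := fun a b => if t.lt a b ∧ R a b then some 1 else none
     one_le := fun a b i h => by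
       split_ifs at h
       simp_all
     asymm := fun a b i h => by
       split_ifs at h with h1
       rw [if_neg fun h2 => t.asymm h1.1 h2.1]
     acyclic := fun i a h => by
       refine t.irrefl a ?_
       have h' : Relation.TransGen t.lt a a := Relation.TransGen.mono (fun x y hxy => by
         split_ifs at hxy with h1
         exact h1.1) _ _ h
       exact @Relation.TransGen.trans_induction_on _ t.lt (fun {x y} _ => t.lt x y) _ _ h'
         (fun h => h) (fun _ _ => t.trans _ _ _) }, fun a b i h => by
    dsimp only at h
    split_ifs at h
    simp_all⟩

theorem TotalOrd.graph_edge {t : TotalOrd (Fin k)} {R : Fin k → Fin k → Prop} {a b : Fin k}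
    {i : ℕ} : (t.graph R).1.edge a b = some i ↔ i = 1 ∧ t.lt a b ∧ R a b := by
  classical
  change (if t.lt a b ∧ R a b then some 1 else none) = some i ↔ _
  split_ifs with h
  · simp [h, eq_comm]
  · simp [h]

theorem TotalOrd.graph_blank {t : TotalOrd (Fin k)} {R : Fin k → Fin k → Prop} {a b : Fin k} :
    (t.graph R).1.Blank a b ↔ ¬ (t.lt a b ∧ R a b) ∧ ¬ (t.lt b a ∧ R b a) := by
  simp only [PartialGraph.Blank, Option.eq_none_iff_forall_ne_some, ne_eq, TotalOrd.graph_edge]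
  grind

theorem KHat.exists_extendedBy (l : KHat 1 k) : ∃ t, l.ExtendedBy t := by
  let E : Fin k → Fin k → Prop := fun a b => l.1.edge a b = some 1
  have hpo : IsPartialOrder (Fin k) (Relation.ReflTransGen E) :=
    { refl := fun _ => Relation.ReflTransGen.refl
      trans := fun _ _ _ => Relation.ReflTransGen.trans
      antisymm := fun a b h1 h2 => by
        by_contra hab
        rcases Relation.reflTransGen_iff_eq_or_transGen.1 h1 with h | h
        · exact hab h.symm
        · exact l.1.acyclic 1 a (h.trans_left h2) }
  obtain ⟨s, hs, hle⟩ := extend_partialOrder (Relation.ReflTransGen E)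
  refine ⟨⟨fun a b => s a b ∧ a ≠ b, fun a h => h.2 rfl, fun a b c h h' =>
    ⟨hs.trans _ _ _ h.1 h'.1, ?_⟩, fun a b h => ?_⟩, fun a b i h => ⟨?_, ?_⟩⟩
  · rintro rfl
    exact h.2 (hs.antisymm _ _ h.1 h'.1)
  · exact (hs.total a b).imp (fun h' => ⟨h', h⟩) (fun h' => ⟨h', h.symm⟩)
  · have hi : i = 1 := le_antisymm (l.2 a b i h) (l.1.one_le a b i h)
    exact hle _ _ (Relation.ReflTransGen.single (show l.1.edge a b = some 1 by rw [h, hi]))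
  · rintro rfl
    simp [l.1.edge_self] at h

theorem KHat.ExtendedBy.of_le {l l' : KHat 1 k} (h : l' ≤ l) {t : TotalOrd (Fin k)}
    (ht : l'.ExtendedBy t) : l.ExtendedBy t := fun a b i hi => ht a b i (KHat.edge_of_le h hi)

/-- The graph all of whose edges are coloured and oriented along `t`. -/
noncomputable abbrev TotalOrd.fullGraph (t : TotalOrd (Fin k)) : KHat 1 k :=
  t.graph fun _ _ => True

theorem TotalOrd.fullGraph_not_blank (t : TotalOrd (Fin k)) {a b : Fin k} (h : a ≠ b) :
    ¬ t.fullGraph.1.Blank a b := by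
  rw [TotalOrd.graph_blank]
  have := t.total a b h
  tauto

theorem TotalOrd.fullGraph_le {t : TotalOrd (Fin k)} {l : KHat 1 k} (h : l.ExtendedBy t) :
    t.fullGraph ≤ l := by
  refine ⟨fun a b hab => ?_, fun a b i hi => ?_⟩
  · by_cases hne : a = b
    · subst hne
      exact ⟨l.1.edge_self a, l.1.edge_self a⟩
    · exact absurd hab (t.fullGraph_not_blank hne)
  · obtain ⟨rfl, hab, -⟩ := TotalOrd.graph_edge.1 hi
    by_cases hb : l.1.Blank a b
    · exact Or.inl hb
    have hba : l.1.edge b a = none := Option.eq_none_iff_forall_ne_some.2 fun j hj =>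
      t.asymm hab (h _ _ _ hj)
    obtain ⟨j, hj⟩ := Option.ne_none_iff_exists'.1 fun h' => hb ⟨h', hba⟩
    exact Or.inr (Or.inl ⟨j, l.1.one_le _ _ _ hj, hj⟩)

/-- The graph in which the edges between overlapping cubes are coloured and oriented along `t`. -/
noncomputable abbrev TotalOrd.overlapGraph (t : TotalOrd (Fin k)) (c : Fin k → LittleCube n) :
    KHat 1 k := t.graph fun a b => ¬ (c a).DisjointInteriors (c b)

theorem TotalOrd.mem_ASet_overlapGraph (t : TotalOrd (Fin k)) (c : Fin k → LittleCube n) :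
    c ∈ ASet n (t.overlapGraph c) := by
  intro p q hpq hb
  by_contra hd
  rw [TotalOrd.graph_blank] at hb
  rcases t.total p q hpq with h | h
  · exact hb.1 ⟨h, hd⟩
  · exact hb.2 ⟨h, fun h' => hd h'.symm⟩

theorem SameOnOverlaps.extendedBy {c : Fin k → LittleCube n} {t t' : TotalOrd (Fin k)}
    (h : SameOnOverlaps c t t') : (t.overlapGraph c).ExtendedBy t' := by
  intro a b i hi
  obtain ⟨-, hab, hd⟩ := TotalOrd.graph_edge.1 hi
  exact (h a b (fun e => t.irrefl b (e ▸ hab)) hd).1 hab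

theorem TotalOrd.overlapGraph_extendedBy (t : TotalOrd (Fin k)) (c : Fin k → LittleCube n) :
    (t.overlapGraph c).ExtendedBy t :=
  SameOnOverlaps.extendedBy fun _ _ _ _ => Iff.rfl

theorem TotalOrd.mem_ASet_fullGraph (t : TotalOrd (Fin k)) (c : Fin k → LittleCube n) :
    c ∈ ASet n t.fullGraph := fun _ _ hpq hb => absurd hb (t.fullGraph_not_blank hpq)

theorem KHat.ExtendedBy.sameOnOverlaps {l : KHat 1 k} {t t' : TotalOrd (Fin k)}
    (h : l.ExtendedBy t) (h' : l.ExtendedBy t') {c : Fin k → LittleCube n} (hc : c ∈ ASet n l) :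
    SameOnOverlaps c t t' := by
  intro a b hab hd
  have hb : ¬ (l.1.edge a b = none ∧ l.1.edge b a = none) := fun hb => hd (hc a b hab hb)
  by_cases h1 : l.1.edge a b = none
  · obtain ⟨j, hj⟩ := Option.ne_none_iff_exists'.1 fun h2 => hb ⟨h1, h2⟩
    exact iff_of_false (t.asymm (h _ _ _ hj)) (t'.asymm (h' _ _ _ hj))
  · obtain ⟨j, hj⟩ := Option.ne_none_iff_exists'.1 h1
    exact iff_of_true (h _ _ _ hj) (h' _ _ _ hj)

end Graphs

/-! ### The smallest complementary graph of a family of cubes -/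

section MinGraph

variable {n k : ℕ}

/-- `i` is the first direction in which one of the cubes `c_a`, `c_b` precedes the other one, and
it is `c_a` that precedes `c_b`. -/
def FirstDir (c : Fin k → LittleCube n) (a b : Fin k) (i : Fin n) : Prop :=
  (c a).LtDir i (c b) ∧ ∀ j < i, ¬ (c a).LtDir j (c b) ∧ ¬ (c b).LtDir j (c a)

theorem FirstDir.unique {c : Fin k → LittleCube n} {a b : Fin k} {i i' : Fin n}
    (h : FirstDir c a b i) (h' : FirstDir c a b i') : i = i' := by
  rcases lt_trichotomy i i' with hlt | heq | hgt
  · exact absurd h.1 (h'.2 i hlt).1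
  · exact heq
  · exact absurd h'.1 (h.2 i' hgt).1

theorem FirstDir.asymm {c : Fin k → LittleCube n} {a b : Fin k} {i i' : Fin n}
    (h : FirstDir c a b i) (h' : FirstDir c b a i') : False := by
  rcases lt_trichotomy i i' with hlt | rfl | hgt
  · exact (h'.2 i hlt).2 h.1
  · exact h.1.asymm h'.1
  · exact (h.2 i' hgt).2 h'.1

theorem exists_firstDir {c : Fin k → LittleCube n} {a b : Fin k} {i : Fin n}
    (h : (c a).LtDir i (c b) ∨ (c b).LtDir i (c a)) :
    ∃ j ≤ i, FirstDir c a b j ∨ FirstDir c b a j := by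
  classical
  let S : Finset (Fin n) := {i | (c a).LtDir i (c b) ∨ (c b).LtDir i (c a)}
  have hS : S.Nonempty := ⟨i, by simpa [S] using h⟩
  have hmin : ∀ j < S.min' hS, ¬ (c a).LtDir j (c b) ∧ ¬ (c b).LtDir j (c a) := fun j hj => by
    rw [← not_or]
    exact fun h' => absurd (S.min'_le j (by simpa [S] using h')) (not_le.2 hj)
  have hmem : (c a).LtDir (S.min' hS) (c b) ∨ (c b).LtDir (S.min' hS) (c a) := by
    simpa [S] using S.min'_mem hS
  refine ⟨S.min' hS, S.min'_le i (by simpa [S] using h), ?_⟩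
  exact hmem.imp (fun h' => ⟨h', hmin⟩) (fun h' => ⟨h', fun j hj => (hmin j hj).symm⟩)

theorem ltDir_of_transGen {c : Fin k → LittleCube n} {i : Fin n} {a b : Fin k}
    (h : Relation.TransGen (fun x y => (c x).LtDir i (c y)) a b) : (c a).LtDir i (c b) := by
  induction h with
  | single h => exact h
  | tail _ h ih => exact ih.trans h

open Classical in
/-- The graph that colours and orients every edge which is blank in `l` by the first direction in
which the corresponding cubes are comparable. -/
noncomputable def minGraph (l : KHat 1 k) (c : Fin k → LittleCube n) : KHat n k :=
  let E : Fin k → Fin k → Option ℕ := fun a b =>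
    if h : l.1.Blank a b ∧ ∃ i, FirstDir c a b i then some (h.2.choose.1 + 1) else none
  have hE : ∀ {a b j}, E a b = some j → ∃ i : Fin n, j = i + 1 ∧ FirstDir c a b i := by
    intro a b j h
    by_cases h1 : l.1.Blank a b ∧ ∃ i, FirstDir c a b i
    · simp only [E, dif_pos h1, Option.some.injEq] at h
      exact ⟨h1.2.choose, h.symm, h1.2.choose_spec⟩
    · simp [E, dif_neg h1] at h
  ⟨{ edge := E
     one_le := fun a b i h => by
       obtain ⟨i', rfl, -⟩ := hE h
       omega
     asymm := fun a b i h => by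
       obtain ⟨i', -, h1⟩ := hE h
       exact dif_neg fun h2 => h1.asymm h2.2.choose_spec
     acyclic := fun i a h => by
       obtain ⟨b, hb, -⟩ := Relation.TransGen.head'_iff.1 h
       obtain ⟨i', rfl, -⟩ := hE hb
       have h' : (c a).LtDir i' (c a) := by
         refine ltDir_of_transGen (Relation.TransGen.mono (fun x y hxy => ?_) _ _ h)
         obtain ⟨i'', hi, h1⟩ := hE hxy
         obtain rfl : i' = i'' := Fin.ext (by omega)
         exact h1.1
       exact h'.asymm h' }, fun a b i h => by
    obtain ⟨i', rfl, -⟩ := hE h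
    exact i'.2⟩

theorem minGraph_edge {l : KHat 1 k} {c : Fin k → LittleCube n} {a b : Fin k} {j : ℕ} :
    (minGraph l c).1.edge a b = some j ↔
      l.1.Blank a b ∧ ∃ i : Fin n, j = i + 1 ∧ FirstDir c a b i := by
  classical
  change (if h : l.1.Blank a b ∧ ∃ i, FirstDir c a b i then some (h.2.choose.1 + 1) else none) =
    some j ↔ _
  split_ifs with h
  · rw [Option.some.injEq]
    constructor
    · rintro rfl
      exact ⟨h.1, _, rfl, h.2.choose_spec⟩
    · rintro ⟨-, i, rfl, hi⟩
      rw [h.2.choose_spec.unique hi]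
  · simp only [false_iff]
    rintro ⟨h1, i, -, hi⟩
    exact h ⟨h1, i, hi⟩

theorem isComplementary_minGraph {l : KHat 1 k} {c : Fin k → LittleCube n} (hc : c ∈ ASet n l) :
    IsComplementary l (minGraph l c) := by
  rw [isComplementary_iff]
  intro a b hab
  change ((minGraph l c).1.edge a b = none ∧ (minGraph l c).1.edge b a = none) ↔ _
  simp only [Option.eq_none_iff_forall_ne_some, ne_eq,
    minGraph_edge]
  constructor
  · rintro ⟨h1, h2⟩ hb
    obtain ⟨i, hi⟩ := LittleCube.disjointInteriors_iff.1 (hc a b hab hb)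
    obtain ⟨j, -, hj | hj⟩ := exists_firstDir hi
    · exact h1 _ ⟨hb, j, rfl, hj⟩
    · exact h2 _ ⟨hb.symm, j, rfl, hj⟩
  · exact fun hb => ⟨fun j hj => hb hj.1, fun j hj => hb hj.1.symm⟩

theorem mem_HSet_minGraph (l : KHat 1 k) (c : Fin k → LittleCube n) : c ∈ HSet (minGraph l c) := by
  intro p q i hi
  obtain ⟨-, i', h, hi'⟩ := minGraph_edge.1 hi
  obtain rfl : i = i' := Fin.ext (by omega)
  exact hi'.1

theorem blank_of_edge {l : KHat 1 k} (m : TPoset n k l) {a b : Fin k} {j : ℕ}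
    (h : m.1.1.edge a b = some j) : l.1.Blank a b := by
  have hab : a ≠ b := by
    rintro rfl
    simp [m.1.1.edge_self] at h
  by_contra hb
  have := (((isComplementary_iff l m.1).1 m.2 a b hab).2 hb).1
  simp_all

/-- An edge of colour `i + 1` in `m` witnesses that the cubes are comparable in direction `i`, so
that their first such direction is at most `i`; in direction `i` itself the orientation is forced. -/
theorem minGraph_le {l : KHat 1 k} (m : TPoset n k l) {c : Fin k → LittleCube n}
    (hc : c ∈ HSet m.1) : minGraph l c ≤ m.1 := by
  have key : ∀ a b j, m.1.1.edge a b = some j → ∃ i : Fin n, j = i + 1 ∧ (c a).LtDir i (c b) := by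
    intro a b j hj
    have h1 := m.1.1.one_le a b j hj
    have h2 := m.1.2 a b j hj
    have hj' : j = (⟨j - 1, by omega⟩ : Fin n).1 + 1 := by
      dsimp only
      omega
    exact ⟨_, hj', hc a b _ (hj.trans (congrArg some hj'))⟩
  refine ⟨fun a b hb => ?_, fun a b j hj => ?_⟩
  · by_contra hm
    have hcases : ∃ x y j, m.1.1.edge x y = some j ∧ (minGraph l c).1.Blank x y := by
      by_cases h1 : m.1.1.edge a b = none
      · obtain ⟨j, hj⟩ := Option.ne_none_iff_exists'.1 fun h2 => hm ⟨h1, h2⟩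
        exact ⟨b, a, j, hj, hb.symm⟩
      · obtain ⟨j, hj⟩ := Option.ne_none_iff_exists'.1 h1
        exact ⟨a, b, j, hj, hb⟩
    obtain ⟨x, y, j, hj, hxy⟩ := hcases
    obtain ⟨i, -, hi⟩ := key x y j hj
    have hbl := blank_of_edge m hj
    obtain ⟨i', -, hi' | hi'⟩ := exists_firstDir (Or.inl hi)
    · have := minGraph_edge.2 ⟨hbl, i', rfl, hi'⟩
      exact absurd (hxy.1.symm.trans this) (by simp)
    · have := minGraph_edge.2 ⟨hbl.symm, i', rfl, hi'⟩
      exact absurd (hxy.2.symm.trans this) (by simp)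
  · obtain ⟨hbl, i, rfl, hi⟩ := minGraph_edge.1 hj
    by_cases hmb : m.1.1.Blank a b
    · exact Or.inl hmb
    refine Or.inr ?_
    by_cases h1 : m.1.1.edge a b = none
    · obtain ⟨j, hj⟩ := Option.ne_none_iff_exists'.1 fun h2 => hmb ⟨h1, h2⟩
      obtain ⟨i', rfl, hi'⟩ := key b a j hj
      refine Or.inr ⟨_, ?_, hj⟩
      rcases lt_trichotomy i i' with hlt | rfl | hgt
      · exact Nat.succ_lt_succ hlt
      · exact absurd hi' hi.1.asymm
      · exact absurd hi' (hi.2 i' hgt).2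
    · obtain ⟨j, hj⟩ := Option.ne_none_iff_exists'.1 h1
      obtain ⟨i', rfl, hi'⟩ := key a b j hj
      refine Or.inl ⟨_, ?_, hj⟩
      have : i ≤ i' := not_lt.1 fun hgt => (hi.2 i' hgt).1 hi'
      exact Nat.succ_le_succ this

theorem FSet_subset_ASet {l : KHat 1 k} (m : TPoset n k l) : FSet l m ⊆ ASet n l := by
  rintro c ⟨m', -, hc⟩ p q hpq hb
  have hnb : ¬ m'.1.1.Blank p q := fun h => ((isComplementary_iff l m'.1).1 m'.2 p q hpq).1 h hb
  have key : ∀ a b j, m'.1.1.edge a b = some j → (c a).DisjointInteriors (c b) := by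
    intro a b j hj
    have h1 := m'.1.1.one_le a b j hj
    have h2 := m'.1.2 a b j hj
    refine LittleCube.disjointInteriors_iff.2 ⟨⟨j - 1, by omega⟩, Or.inl (hc a b _ ?_)⟩
    rw [hj]
    simp only [Option.some.injEq]
    omega
  by_cases h1 : m'.1.1.edge p q = none
  · obtain ⟨j, hj⟩ := Option.ne_none_iff_exists'.1 fun h2 => hnb ⟨h1, h2⟩
    exact (key _ _ _ hj).symm
  · obtain ⟨j, hj⟩ := Option.ne_none_iff_exists'.1 h1
    exact key _ _ _ hj

/-- The smallest element of `T_k(l)` whose space `H` contains `c`. -/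
noncomputable abbrev minT {l : KHat 1 k} {c : Fin k → LittleCube n} (hc : c ∈ ASet n l) :
    TPoset n k l := ⟨minGraph l c, isComplementary_minGraph hc⟩

theorem mem_FSet_minT {l : KHat 1 k} {c : Fin k → LittleCube n} (hc : c ∈ ASet n l) :
    c ∈ FSet l (minT hc) := ⟨_, le_rfl, mem_HSet_minGraph l c⟩

theorem minT_le {l : KHat 1 k} {c : Fin k → LittleCube n} {m : TPoset n k l} (h : c ∈ FSet l m) :
    minT (FSet_subset_ASet m h) ≤ m := by
  obtain ⟨m', hm, hc⟩ := h
  exact le_trans (show minGraph l c ≤ m'.1 from minGraph_le m' hc) hm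

end MinGraph

/-! ### Closedness -/

section Closed

variable {n k : ℕ}

instance : Finite (KHat n k) := by
  have : Finite {i : ℕ // i ≤ n} := (Set.finite_Iic n).to_subtype
  refine Finite.of_injective (β := Fin k → Fin k → Option {i : ℕ // i ≤ n})
    (fun g a b => (g.1.edge a b).attach.map fun x => ⟨x.1, g.2 a b x.1 x.2⟩) fun g g' h => ?_
  refine Subtype.ext (PartialGraph.ext (funext fun a => funext fun b => ?_))
  have h' := congrArg (Option.map Subtype.val) (congrFun (congrFun h a) b)
  simpa [Option.map_map, Function.comp_def] using h'

theorem isClosed_HSet (m : KHat n k) : IsClosed (HSet m) := by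
  have h : HSet m = ⋂ p, ⋂ q, ⋂ i : Fin n, ⋂ _ : m.1.edge p q = some (i.1 + 1),
      {c | (c p).LtDir i (c q)} := by
    ext c
    simp [HSet]
  rw [h]
  exact isClosed_iInter fun p => isClosed_iInter fun q => isClosed_iInter fun i =>
    isClosed_iInter fun _ => LittleCube.isClosed_ltDir (continuous_apply p) (continuous_apply q) i

theorem isClosed_FSet (l : KHat 1 k) (m : TPoset n k l) : IsClosed (FSet l m) := by
  have h : FSet l m = ⋃ m' : TPoset n k l, ⋃ _ : m' ≤ m, HSet m'.1 := by
    ext c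
    simp [FSet]
  rw [h]
  exact isClosed_iUnion_of_finite fun m' => isClosed_iUnion_of_finite fun _ => isClosed_HSet m'.1

end Closed

/-! ### The colimits -/

section Colimits

variable {n k : ℕ}

/-- A cocone over a diagram of spaces is a colimit if every object of the diagram maps to one of
the objects `o t`, the sum of whose spaces has the vertex of the cocone as a quotient, and if the
points of this sum that are identified in the vertex are identified by every cocone. -/
theorem nonempty_isColimit_of_isQuotientMap {J : Type} [Category.{0} J] {G : J ⥤ TopCat.{0}}
    (s₀ : Limits.Cocone G) {T : Type} (o : T → J)
    (hq : Topology.IsQuotientMap (Y := s₀.pt)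
      (fun x : Σ t, G.obj (o t) => (s₀.ι.app (o x.1)).hom x.2))
    (ho : ∀ Y, ∃ t, Nonempty (Y ⟶ o t))
    (hglue : ∀ (s : Limits.Cocone G) (x y : Σ t, G.obj (o t)),
      (s₀.ι.app (o x.1)).hom x.2 = (s₀.ι.app (o y.1)).hom y.2 →
      (s.ι.app (o x.1)).hom x.2 = (s.ι.app (o y.1)).hom y.2) :
    Nonempty (Limits.IsColimit s₀) := by
  let q : C(Σ t, G.obj (o t), s₀.pt) := ⟨_, hq.continuous⟩
  have hq' : Topology.IsQuotientMap q := hq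
  let d : ∀ s : Limits.Cocone G, C(Σ t, G.obj (o t), s.pt) := fun s =>
    ⟨fun x => (s.ι.app (o x.1)).hom x.2, continuous_sigma fun t => (s.ι.app (o t)).hom.continuous⟩
  have hlift : ∀ (s : Limits.Cocone G) (t : T) (x : G.obj (o t)),
      hq'.lift (d s) (fun x y h => hglue s x y h) ((s₀.ι.app (o t)).hom x) =
        (s.ι.app (o t)).hom x := fun s t x =>
    DFunLike.congr_fun (hq'.lift_comp (d s) (fun x y h => hglue s x y h))
      (⟨t, x⟩ : Σ t, G.obj (o t))
  refine ⟨{ desc := fun s => TopCat.ofHom (hq'.lift (d s) (fun x y h => hglue s x y h))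
            fac := fun s Y => ?_, uniq := fun s φ hφ => ?_ }⟩
  · obtain ⟨t, ⟨u⟩⟩ := ho Y
    rw [← s₀.w u, ← s.w u, Category.assoc]
    congr 1
    ext x
    exact hlift s t x
  · ext y
    obtain ⟨⟨t, x⟩, rfl⟩ := hq.surjective y
    refine Eq.trans ?_ (hlift s t x).symm
    rw [← hφ]
    rfl

/-- A cocone identifies the images of a point along any two morphisms. -/
theorem cocone_app_eq {J : Type} [Category.{0} J] {G : J ⥤ TopCat.{0}}
    (s : Limits.Cocone G) {Z Y : J} (u : Z ⟶ Y) (z : G.obj Z) :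
    (s.ι.app Y).hom ((G.map u).hom z) = (s.ι.app Z).hom z := by
  rw [← s.w u]
  rfl

section Tensor

variable {P : TopOperad} {i : Hom assOperad P} {j : Hom (cubesOperad n) P}

/-- The cocone of ordered products over `A`. At `l` the factors are multiplied in a chosen total order
extending `l`; by `aCocone_app` any other one gives the same operation. -/
noncomputable def aCocone (hP : IsTensorProduct i j) (k : ℕ) :
    ADiagram n k ⟶ (Functor.const _).obj (TopCat.of (P.Op (Fin k))) where
  app l := TopCat.ofHom ⟨fun c : ASet n l.unop =>
      orderedProduct i j (KHat.exists_extendedBy l.unop).choose c.1,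
    (continuous_orderedProduct i j _).comp continuous_subtype_val⟩
  naturality l l' u := by
    ext c
    have hle : l'.unop ≤ l.unop := leOfHom u.unop
    exact hP.orderedProduct_eq_iff.2 ⟨rfl, KHat.ExtendedBy.sameOnOverlaps
      ((KHat.exists_extendedBy l'.unop).choose_spec.of_le hle)
      (KHat.exists_extendedBy l.unop).choose_spec c.2⟩

theorem aCocone_app (hP : IsTensorProduct i j) (l : (KHat 1 k)ᵒᵖ) (c : ASet n l.unop)
    {t : TotalOrd (Fin k)} (ht : l.unop.ExtendedBy t) :
    ((aCocone hP k).app l).hom c = orderedProduct i j t c.1 :=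
  hP.orderedProduct_eq_iff.2 ⟨rfl, KHat.ExtendedBy.sameOnOverlaps
    (KHat.exists_extendedBy l.unop).choose_spec ht c.2⟩

theorem aCocone_isColimit (hP : IsTensorProduct i j) (k : ℕ) :
    Nonempty (Limits.IsColimit (Limits.Cocone.mk _ (aCocone hP k))) := by
  have happ : ∀ (t : TotalOrd (Fin k)) (c : ASet n t.fullGraph),
      ((aCocone hP k).app (Opposite.op t.fullGraph)).hom c = orderedProduct i j t c.1 :=
    fun t c => aCocone_app hP (Opposite.op t.fullGraph) c
      (fun _ _ _ h => (TotalOrd.graph_edge.1 h).2.1)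
  refine nonempty_isColimit_of_isQuotientMap (G := ADiagram n k) _
    (fun t : TotalOrd (Fin k) => Opposite.op t.fullGraph) ?_ (fun l => ?_) ?_
  · let e : TotalOrd (Fin k) × (Fin k → LittleCube n) →
        Σ t : TotalOrd (Fin k), (ADiagram n k).obj (Opposite.op t.fullGraph) :=
      fun x => ⟨x.1, (⟨x.2, x.1.mem_ASet_fullGraph x.2⟩ : ASet n x.1.fullGraph)⟩
    have hincl : ∀ t : TotalOrd (Fin k), Continuous fun c : Fin k → LittleCube n =>
        (⟨c, t.mem_ASet_fullGraph c⟩ : ASet n t.fullGraph) := fun t =>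
      Continuous.subtype_mk continuous_id _
    have he : Continuous e := continuous_prod_of_discrete_left.2 fun t =>
      Continuous.comp (g := Sigma.mk t) continuous_sigmaMk (hincl t)
    refine Topology.IsQuotientMap.of_comp he
      (continuous_sigma fun t => (((aCocone hP k).app _).hom).continuous) ?_
    refine (congrArg Topology.IsQuotientMap (funext fun x => ?_)).mp
      (hP.isQuotientMap_orderedProduct (Fin k))
    exact (happ x.1 ⟨x.2, x.1.mem_ASet_fullGraph x.2⟩).symm
  · obtain ⟨t, ht⟩ := KHat.exists_extendedBy l.unop
    exact ⟨t, ⟨(homOfLE (TotalOrd.fullGraph_le ht)).op⟩⟩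
  · rintro s ⟨t, c⟩ ⟨t', c'⟩ h
    obtain ⟨hc, hs⟩ := hP.orderedProduct_eq_iff.1 ((happ t c).symm.trans (h.trans (happ t' c')))
    -- both points come from the graph of overlaps
    let z : ASet n (t.overlapGraph c.1) := ⟨c.1, t.mem_ASet_overlapGraph c.1⟩
    have h1 := cocone_app_eq s (Z := Opposite.op (t.overlapGraph c.1))
      (homOfLE (TotalOrd.fullGraph_le (t.overlapGraph_extendedBy c.1))).op z
    have h2 := cocone_app_eq s (Z := Opposite.op (t.overlapGraph c.1))
      (homOfLE (TotalOrd.fullGraph_le hs.extendedBy)).op z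
    have hc' : c' = (⟨c.1, t'.mem_ASet_fullGraph c.1⟩ : ASet n t'.fullGraph) := Subtype.ext hc.symm
    dsimp only
    rw [hc']
    exact h1.trans h2.symm

/-- A morphism of the Grothendieck construction from its components. -/
noncomputable def GrothT.homMk {X Y : GrothT n k} (h : Y.fst ≤ X.fst) (h' : TMap h X.snd ≤ Y.snd) : X ⟶ Y :=
  ⟨(homOfLE h).op, (homOfLE h' : TMap h X.snd ⟶ Y.snd)⟩

/-- The object of the Grothendieck construction with given components. -/
def GrothT.mk (l : KHat 1 k) (m : TPoset n k l) : GrothT n k := ⟨Opposite.op l, m⟩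

/-- The graph without coloured edges. -/
def blankGraph (n k : ℕ) : KHat n k :=
  ⟨{ edge := fun _ _ => none
     one_le := fun _ _ _ h => by simp at h
     asymm := fun _ _ _ h => by simp at h
     acyclic := fun i a h => by
       obtain ⟨b, hb, -⟩ := Relation.TransGen.head'_iff.1 h
       simp at hb }, fun _ _ _ h => by simp at h⟩

theorem le_blankGraph (m : KHat n k) : m ≤ blankGraph n k :=
  ⟨fun _ _ _ => ⟨rfl, rfl⟩, fun _ _ _ _ => Or.inl ⟨rfl, rfl⟩⟩

variable (n) in
/-- The object of the Grothendieck construction given by a total order: all edges are coloured in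
the first component and blank in the second one. -/
noncomputable abbrev TotalOrd.grothObj (t : TotalOrd (Fin k)) : GrothT n k :=
  GrothT.mk t.fullGraph ⟨blankGraph n k, (isComplementary_iff _ _).2 fun _ _ hab =>
    iff_of_true ⟨rfl, rfl⟩ (t.fullGraph_not_blank hab)⟩

theorem TotalOrd.mem_FSet_grothObj (t : TotalOrd (Fin k)) (c : Fin k → LittleCube n) :
    c ∈ FSet (TotalOrd.grothObj n t).fst (TotalOrd.grothObj n t).snd :=
  ⟨_, le_rfl, fun _ _ _ h => absurd (show none = _ from h) (by simp)⟩

theorem TotalOrd.nonempty_hom_grothObj {X : GrothT n k} {t : TotalOrd (Fin k)}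
    (ht : X.fst.ExtendedBy t) : Nonempty (X ⟶ TotalOrd.grothObj n t) :=
  ⟨GrothT.homMk (TotalOrd.fullGraph_le ht) (le_blankGraph _)⟩

/-- The cocone of ordered products over `F_k`, defined as for `A` by choosing total orders. -/
noncomputable def fCocone (hP : IsTensorProduct i j) (k : ℕ) :
    FDiagram n k ⟶ (Functor.const _).obj (TopCat.of (P.Op (Fin k))) where
  app X := TopCat.ofHom ⟨fun c : FSet X.fst X.snd =>
      orderedProduct i j (KHat.exists_extendedBy X.fst).choose c.1,
    (continuous_orderedProduct i j _).comp continuous_subtype_val⟩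
  naturality X Y u := by
    ext c
    have hle : Y.fst ≤ X.fst := leOfHom u.base.unop
    exact hP.orderedProduct_eq_iff.2 ⟨rfl, KHat.ExtendedBy.sameOnOverlaps
      ((KHat.exists_extendedBy Y.fst).choose_spec.of_le hle)
      (KHat.exists_extendedBy X.fst).choose_spec (FSet_subset_ASet _ c.2)⟩

theorem fCocone_app (hP : IsTensorProduct i j) (X : GrothT n k) (c : FSet X.fst X.snd)
    {t : TotalOrd (Fin k)} (ht : X.fst.ExtendedBy t) :
    ((fCocone hP k).app X).hom c = orderedProduct i j t c.1 :=
  hP.orderedProduct_eq_iff.2 ⟨rfl, KHat.ExtendedBy.sameOnOverlaps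
    (KHat.exists_extendedBy X.fst).choose_spec ht (FSet_subset_ASet _ c.2)⟩

theorem fCocone_isColimit (hP : IsTensorProduct i j) (k : ℕ) :
    Nonempty (Limits.IsColimit (Limits.Cocone.mk _ (fCocone hP k))) := by
  have happ : ∀ (t : TotalOrd (Fin k))
      (c : FSet (TotalOrd.grothObj n t).fst (TotalOrd.grothObj n t).snd),
      ((fCocone hP k).app (TotalOrd.grothObj n t)).hom c = orderedProduct i j t c.1 :=
    fun t c => fCocone_app hP (TotalOrd.grothObj n t) c
      (fun _ _ _ h => (TotalOrd.graph_edge.1 h).2.1)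
  refine nonempty_isColimit_of_isQuotientMap (G := FDiagram n k) _
    (fun t : TotalOrd (Fin k) => TotalOrd.grothObj n t) ?_ (fun X => ?_) ?_
  · let e : TotalOrd (Fin k) × (Fin k → LittleCube n) →
        Σ t : TotalOrd (Fin k), (FDiagram n k).obj (TotalOrd.grothObj n t) :=
      fun x => ⟨x.1, (⟨x.2, x.1.mem_FSet_grothObj x.2⟩ :
        FSet (TotalOrd.grothObj n x.1).fst (TotalOrd.grothObj n x.1).snd)⟩
    have hincl : ∀ t : TotalOrd (Fin k), Continuous fun c : Fin k → LittleCube n =>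
        (⟨c, t.mem_FSet_grothObj c⟩ :
          FSet (TotalOrd.grothObj n t).fst (TotalOrd.grothObj n t).snd) := fun t =>
      Continuous.subtype_mk continuous_id _
    have he : Continuous e := continuous_prod_of_discrete_left.2 fun t =>
      Continuous.comp (g := Sigma.mk t) continuous_sigmaMk (hincl t)
    refine Topology.IsQuotientMap.of_comp he
      (continuous_sigma fun t => (((fCocone hP k).app _).hom).continuous) ?_
    refine (congrArg Topology.IsQuotientMap (funext fun x => ?_)).mp
      (hP.isQuotientMap_orderedProduct (Fin k))
    exact (happ x.1 ⟨x.2, x.1.mem_FSet_grothObj x.2⟩).symm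
  · obtain ⟨t, ht⟩ := KHat.exists_extendedBy X.fst
    exact ⟨t, TotalOrd.nonempty_hom_grothObj ht⟩
  · rintro s ⟨t, c⟩ ⟨t', c'⟩ h
    obtain ⟨hc, hs⟩ := hP.orderedProduct_eq_iff.1 ((happ t c).symm.trans (h.trans (happ t' c')))
    -- both points come from the graph of overlaps and its smallest complementary graph
    let Z : GrothT n k := GrothT.mk (t.overlapGraph c.1) (minT (t.mem_ASet_overlapGraph c.1))
    let z : FSet Z.fst Z.snd := ⟨c.1, mem_FSet_minT (t.mem_ASet_overlapGraph c.1)⟩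
    obtain ⟨u⟩ : Nonempty (Z ⟶ TotalOrd.grothObj n t) :=
      TotalOrd.nonempty_hom_grothObj (t.overlapGraph_extendedBy c.1)
    obtain ⟨u'⟩ : Nonempty (Z ⟶ TotalOrd.grothObj n t') :=
      TotalOrd.nonempty_hom_grothObj hs.extendedBy
    have h1 := cocone_app_eq s u z
    have h2 := cocone_app_eq s u' z
    have hc' : c' = (⟨c.1, t'.mem_FSet_grothObj c.1⟩ :
      FSet (TotalOrd.grothObj n t').fst (TotalOrd.grothObj n t').snd) := Subtype.ext hc.symm
    dsimp only
    rw [hc']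
    exact h1.trans h2.symm

end Tensor

/-- The cocone of inclusions of the spaces `F_k(l)(m)` into `A(l)`. -/
def fiberCocone (n : ℕ) (l : KHat 1 k) :
    FFiber n l ⟶ (Functor.const _).obj (TopCat.of (ASet n l)) where
  app m := inclHom (FSet_subset_ASet m)
  naturality _ _ _ := rfl

theorem isClosedMap_fiberCocone (l : KHat 1 k) (m : TPoset n k l) :
    IsClosedMap ((fiberCocone n l).app m).hom :=
  (isClosed_FSet l m).isClosedMap_inclusion (FSet_subset_ASet m)

theorem fiberCocone_isColimit (l : KHat 1 k) :
    Nonempty (Limits.IsColimit (Limits.Cocone.mk _ (fiberCocone n l))) := by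
  refine nonempty_isColimit_of_isQuotientMap (G := FFiber n l) _ (fun m : TPoset n k l => m) ?_
    (fun m => ⟨m, ⟨𝟙 m⟩⟩) ?_
  · refine IsClosedMap.isQuotientMap (fun Z hZ => ?_) (continuous_sigma fun m =>
      ((fiberCocone n l).app m).hom.continuous) fun c => ?_
    · have hU : (fun x : Σ m, (FFiber n l).obj m => ((fiberCocone n l).app x.1).hom x.2) '' Z =
          ⋃ m, ((fiberCocone n l).app m).hom '' ((fun c => (⟨m, c⟩ : Σ m, (FFiber n l).obj m)) ⁻¹' Z) := by
        ext y
        simp only [Set.mem_image, Set.mem_iUnion, Sigma.exists, Set.mem_preimage]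
      refine (congrArg IsClosed hU).mpr (isClosed_iUnion_of_finite fun m => ?_)
      exact isClosedMap_fiberCocone l m _ (hZ.preimage continuous_sigmaMk)
    · exact ⟨⟨minT c.2, (⟨c.1, mem_FSet_minT c.2⟩ : FSet l (minT c.2))⟩, rfl⟩
  · rintro s ⟨m, c⟩ ⟨m', c'⟩ h
    have hc : c.1 = c'.1 := congrArg Subtype.val h
    have hA := FSet_subset_ASet m c.2
    let z : FSet l (minT hA) := ⟨c.1, mem_FSet_minT hA⟩
    have h1 := cocone_app_eq s (Z := minT hA) (Y := m) (homOfLE (minT_le c.2)) z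
    have h2 := cocone_app_eq s (Z := minT hA) (Y := m') (homOfLE (minT_le (hc ▸ c'.2))) z
    have hc' : c' = (⟨c.1, hc ▸ c'.2⟩ : FSet l m') := Subtype.ext hc.symm
    dsimp only
    rw [hc']
    exact h1.trans h2.symm

theorem isEmbedding_desc_below (l : KHat 1 k) (m : TPoset n k l)
    (s : Limits.Cocone (belowIncl m ⋙ FFiber n l)) (hs : Limits.IsColimit s) :
    Topology.IsEmbedding (hs.desc (Limits.Cocone.whisker (belowIncl m)
      (Limits.Cocone.mk _ (fiberCocone n l)))).hom := by
  set δ := hs.desc (Limits.Cocone.whisker (belowIncl m) (Limits.Cocone.mk _ (fiberCocone n l)))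
  have hfac : ∀ (b : Set.Iio m) (c : FSet l b.1),
      (δ.hom ((s.ι.app b).hom c) : ASet n l) = ⟨c.1, FSet_subset_ASet _ c.2⟩ := fun b c => by
    have := hs.fac (Limits.Cocone.whisker (belowIncl m)
      (Limits.Cocone.mk _ (fiberCocone n l))) b
    exact ConcreteCategory.congr_hom this c
  have hrep : ∀ x : s.pt, ∃ (b : Set.Iio m) (c : FSet l b.1), (s.ι.app b).hom c = x := fun x =>
    Limits.Concrete.isColimit_exists_rep _ hs x
  refine (Topology.IsClosedEmbedding.of_continuous_injective_isClosedMap δ.hom.continuous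
    ?_ ?_).isEmbedding
  · intro x y hxy
    obtain ⟨b, c, rfl⟩ := hrep x
    obtain ⟨b', c', rfl⟩ := hrep y
    have hc : c.1 = c'.1 := congrArg Subtype.val
      ((hfac b c).symm.trans (Eq.trans hxy (hfac b' c')))
    -- both points come from the smallest graph, which is still smaller than `m`
    have hA := FSet_subset_ASet b.1 c.2
    have hle : minT hA ≤ b.1 := minT_le c.2
    have hle' : minT hA ≤ b'.1 := minT_le (hc ▸ c'.2)
    let b₀ : Set.Iio m := ⟨minT hA, hle.trans_lt b.2⟩
    let z : FSet l b₀.1 := ⟨c.1, mem_FSet_minT hA⟩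
    have h1 := cocone_app_eq s (Z := b₀) (Y := b) (homOfLE hle) z
    have h2 := cocone_app_eq s (Z := b₀) (Y := b') (homOfLE hle') z
    have hc' : c' = ⟨c.1, hc ▸ c'.2⟩ := Subtype.ext hc.symm
    rw [hc']
    exact h1.trans h2.symm
  · intro Z hZ
    have hU : δ.hom '' Z = ⋃ b : Set.Iio m, ((fiberCocone n l).app b.1).hom ''
        ((s.ι.app b).hom ⁻¹' Z) := by
      ext y
      simp only [Set.mem_image, Set.mem_iUnion]
      constructor
      · rintro ⟨x, hx, rfl⟩
        obtain ⟨b, c, rfl⟩ := hrep x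
        exact ⟨b, c, hx, (hfac b c).symm⟩
      · rintro ⟨b, c, hx, rfl⟩
        exact ⟨_, hx, hfac b c⟩
    rw [hU]
    exact isClosed_iUnion_of_finite fun b =>
      isClosedMap_fiberCocone l b.1 _ (hZ.preimage (s.ι.app b).hom.continuous)

end Colimits

/-! ### The isomorphism of categories -/

section Iso

variable {n k : ℕ}

theorem GrothT.obj_ext {X Y : GrothT n k} (h : X.fst = Y.fst) (h' : X.snd.1 = Y.snd.1) : X = Y := by
  obtain ⟨⟨l⟩, m⟩ := X
  obtain ⟨⟨l'⟩, m'⟩ := Y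
  obtain rfl : l = l' := h
  obtain rfl : m = m' := Subtype.ext h'
  rfl

theorem GrothT.hom_subsingleton {X Y : GrothT n k} (u v : X ⟶ Y) : u = v := by
  refine Grothendieck.ext _ _ (Subsingleton.elim _ _) ?_
  exact Subsingleton.elim (α := (TMap _ X.snd ⟶ Y.snd)) _ _

theorem phiOne_edge {g : KFull (n + 1) k} {a b : Fin k} {i : ℕ} :
    (phiOne g).1.edge a b = some i ↔ i = 1 ∧ g.1.edge a b = some (n + 1) := by
  change (if g.1.edge a b = some (n + 1) then some 1 else none) = some i ↔ _
  split_ifs with h <;> simp [h, eq_comm]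

theorem phiTwo_edge {g : KFull (n + 1) k} {a b : Fin k} {i : ℕ} :
    (phiTwo g).1.edge a b = some i ↔ i ≤ n ∧ g.1.edge a b = some i := by
  change (if g.1.edge a b = some (n + 1) then none else g.1.edge a b) = some i ↔ _
  split_ifs with h
  · simp only [h, false_iff, Option.some.injEq]
    omega
  · refine ⟨fun h1 => ⟨?_, h1⟩, fun h1 => h1.2⟩
    have := g.2.1 a b i h1
    have : i ≠ n + 1 := fun e => h (e ▸ h1)
    omega

theorem PartialGraph.blank_iff {V : Type} {g : PartialGraph V} {a b : V} :
    g.Blank a b ↔ ∀ i, g.edge a b ≠ some i ∧ g.edge b a ≠ some i := by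
  simp only [PartialGraph.Blank, Option.eq_none_iff_forall_ne_some, forall_and]

theorem phiTwo_eq_forget (g : KFull (n + 1) k) :
    (phiTwo g).1 = g.1.forget (phiOne g).1.coloredEdges := by
  ext a b i
  rw [phiTwo_edge, PartialGraph.forget_edge_eq_some, PartialGraph.mem_coloredEdges, not_not,
    PartialGraph.blank_iff]
  simp only [ne_eq, phiOne_edge]
  constructor
  · rintro ⟨h1, h2⟩
    refine ⟨fun j => ⟨fun h => ?_, fun h => ?_⟩, h2⟩
    · rw [h2] at h
      simp only [Option.some.injEq] at h
      omega
    · have := g.1.asymm _ _ _ h2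
      simp [this] at h
  · rintro ⟨h1, h2⟩
    refine ⟨?_, h2⟩
    have h3 := g.2.1 a b i h2
    have : i ≠ n + 1 := fun e => (h1 1).1 ⟨rfl, e ▸ h2⟩
    omega

theorem phiTwo_isComplementary (g : KFull (n + 1) k) : IsComplementary (phiOne g) (phiTwo g) :=
  ⟨g, fun _ _ _ h => (phiOne_edge.1 h).2, phiTwo_eq_forget g⟩

/-- The object `(φ₁(g), φ₂(g))` of the Grothendieck construction. -/
def phiObj (g : KFull (n + 1) k) : GrothT n k :=
  GrothT.mk (phiOne g) ⟨phiTwo g, phiTwo_isComplementary g⟩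

theorem KHat.le_iff {l l' : KHat 1 k} :
    l' ≤ l ↔ ∀ a b i, l.1.edge a b = some i → l'.1.edge a b = some i := by
  refine ⟨fun h a b i hi => KHat.edge_of_le h hi, fun h => ⟨fun a b hb => ?_, fun a b i hi => ?_⟩⟩
  · rw [PartialGraph.blank_iff] at hb ⊢
    exact fun i => ⟨fun h' => (hb i).1 (h a b i h'), fun h' => (hb i).2 (h b a i h')⟩
  · have hi1 := l'.2 a b i hi
    by_cases hb : l.1.Blank a b
    · exact Or.inl hb
    have hba : l.1.edge b a = none := Option.eq_none_iff_forall_ne_some.2 fun j hj => by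
      have := h b a j hj
      simp [l'.1.asymm _ _ _ hi] at this
    obtain ⟨j, hj⟩ := Option.ne_none_iff_exists'.1 fun h' => hb ⟨h', hba⟩
    exact Or.inr (Or.inl ⟨j, hi1.trans (l.1.one_le _ _ _ hj), hj⟩)

/-- For graphs with the same blank edges only the coloured edges have to be compared. -/
theorem PartialGraph.le_of_blank {V : Type} {g h : PartialGraph V}
    (hb : ∀ a b, g.Blank a b ↔ h.Blank a b) :
    g ≤ h ↔ ∀ a b i, g.edge a b = some i →
      (∃ j, i ≤ j ∧ h.edge a b = some j) ∨ ∃ j, i < j ∧ h.edge b a = some j := by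
  refine ⟨fun hle a b i hi => (hle.2 a b i hi).resolve_left fun hbl => ?_,
    fun hle => ⟨fun a b => (hb a b).1, fun a b i hi => Or.inr (hle a b i hi)⟩⟩
  have := ((hb a b).2 hbl).1
  simp [this] at hi

theorem KFull.blank_iff (g : KFull n k) {a b : Fin k} : g.1.Blank a b ↔ a = b :=
  ⟨fun h => by_contra fun hab => g.2.2 a b hab h, by
    rintro rfl
    exact ⟨g.1.edge_self a, g.1.edge_self a⟩⟩

theorem TPoset.blank_iff {l : KHat 1 k} (m : TPoset n k l) {a b : Fin k} :
    m.1.1.Blank a b ↔ a = b ∨ ¬ l.1.Blank a b := by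
  by_cases hab : a = b
  · subst hab
    exact iff_of_true ⟨m.1.1.edge_self a, m.1.1.edge_self a⟩ (Or.inl rfl)
  · rw [(isComplementary_iff l m.1).1 m.2 a b hab]
    tauto

theorem KFull.le_iff {g g' : KFull n k} :
    g ≤ g' ↔ ∀ a b i, g.1.edge a b = some i →
      (∃ j, i ≤ j ∧ g'.1.edge a b = some j) ∨ ∃ j, i < j ∧ g'.1.edge b a = some j :=
  PartialGraph.le_of_blank fun _ _ => g.blank_iff.trans g'.blank_iff.symm

theorem TPoset.le_iff {l : KHat 1 k} {m m' : TPoset n k l} :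
    m ≤ m' ↔ ∀ a b i, m.1.1.edge a b = some i →
      (∃ j, i ≤ j ∧ m'.1.1.edge a b = some j) ∨ ∃ j, i < j ∧ m'.1.1.edge b a = some j :=
  PartialGraph.le_of_blank fun _ _ => m.blank_iff.trans m'.blank_iff.symm

theorem phiOne_le {g g' : KFull (n + 1) k} (h : g ≤ g') : phiOne g' ≤ phiOne g := by
  refine KHat.le_iff.2 fun a b i hi => ?_
  obtain ⟨rfl, hi'⟩ := phiOne_edge.1 hi
  refine phiOne_edge.2 ⟨rfl, ?_⟩
  rcases KFull.le_iff.1 h a b _ hi' with ⟨j, hij, hj⟩ | ⟨j, hij, hj⟩ <;>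
    have hj1 := g'.2.1 _ _ _ hj
  · rw [hj, le_antisymm hj1 hij]
  · omega

theorem mem_coloredEdges_phiOne {g : KFull (n + 1) k} {a b : Fin k} :
    s(a, b) ∈ (phiOne g).1.coloredEdges ↔
      g.1.edge a b = some (n + 1) ∨ g.1.edge b a = some (n + 1) := by
  rw [PartialGraph.mem_coloredEdges, PartialGraph.blank_iff]
  simp only [ne_eq, phiOne_edge]
  grind

theorem TMap_phiObj_le {g g' : KFull (n + 1) k} (h : g ≤ g') :
    TMap (phiOne_le h) (phiObj g).snd ≤ (phiObj g').snd := by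
  refine TPoset.le_iff.2 fun a b i hi => ?_
  obtain ⟨hS, hi⟩ := (TMap_edge_eq_some _ _).1 hi
  replace hi := (phiTwo_edge.1 hi).2
  rw [mem_coloredEdges_phiOne, not_or] at hS
  refine (KFull.le_iff.1 h a b i hi).imp ?_ ?_ <;>
  · rintro ⟨j, hij, hj⟩
    have hj1 := g'.2.1 _ _ _ hj
    have hj2 : j ≠ n + 1 := by
      rintro rfl
      tauto
    exact ⟨j, hij, phiTwo_edge.2 ⟨by omega, hj⟩⟩

/-- The comparison functor reflects the order, so that it is full. -/
theorem le_of_phiObj_hom {g g' : KFull (n + 1) k} (u : phiObj g ⟶ phiObj g') : g ≤ g' := by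
  have h1 : phiOne g' ≤ phiOne g := leOfHom u.base.unop
  have h2 : TMap h1 (phiObj g).snd ≤ (phiObj g').snd :=
    leOfHom (show TMap h1 (phiObj g).snd ⟶ (phiObj g').snd from u.fiber)
  refine KFull.le_iff.2 fun a b i hi => ?_
  have hin := g.2.1 a b i hi
  by_cases hn : i = n + 1
  · subst hn
    exact Or.inl ⟨_, le_rfl, (phiOne_edge.1 (KHat.edge_of_le h1 (phiOne_edge.2 ⟨rfl, hi⟩))).2⟩
  by_cases hS : s(a, b) ∈ (phiOne g').1.coloredEdges
  · exact (mem_coloredEdges_phiOne.1 hS).imp (fun h => ⟨_, hin, h⟩) (fun h => ⟨_, by omega, h⟩)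
  · have hm : (TMap h1 (phiObj g).snd).1.1.edge a b = some i :=
      (TMap_edge_eq_some _ _).2 ⟨hS, phiTwo_edge.2 ⟨by omega, hi⟩⟩
    exact (TPoset.le_iff.1 h2 a b i hm).imp (fun ⟨j, hj, h⟩ => ⟨j, hj, (phiTwo_edge.1 h).2⟩)
      (fun ⟨j, hj, h⟩ => ⟨j, hj, (phiTwo_edge.1 h).2⟩)

/-- A preimage of `X` is the fully coloured graph from which `X.snd` arises by blanking edges. -/
theorem phiObj_surjective (X : GrothT n k) : ∃ g, phiObj g = X := by
  obtain ⟨f, hf, hm⟩ := X.snd.2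
  have h1 : phiOne f = X.fst := by
    refine Subtype.ext (PartialGraph.ext (funext fun a => funext fun b => Option.ext fun i => ?_))
    rw [phiOne_edge]
    constructor
    · rintro ⟨rfl, h⟩
      -- an edge of colour `n + 1` survives in `X.snd` unless it is coloured in `X.fst`
      have hS : s(a, b) ∈ X.fst.1.coloredEdges := by
        by_contra hS
        have := X.snd.1.2 a b (n + 1) (by rw [hm]; exact PartialGraph.forget_edge_eq_some.2 ⟨hS, h⟩)
        omega
      rw [PartialGraph.mem_coloredEdges] at hS
      have hba : X.fst.1.edge b a = none := Option.eq_none_iff_forall_ne_some.2 fun j hj => by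
        have := f.1.asymm _ _ _ (hf b a j hj)
        simp [h] at this
      obtain ⟨j, hj⟩ := Option.ne_none_iff_exists'.1 fun h' => hS ⟨h', hba⟩
      have := X.fst.2 _ _ _ hj
      have := X.fst.1.one_le _ _ _ hj
      rw [hj, show j = 1 by omega]
    · intro h
      have := X.fst.2 _ _ _ h
      have := X.fst.1.one_le _ _ _ h
      exact ⟨by omega, hf a b i h⟩
  refine ⟨f, GrothT.obj_ext h1 (Subtype.ext ?_)⟩
  rw [hm, ← h1]
  exact phiTwo_eq_forget f

theorem phiObj_injective : Function.Injective (phiObj : KFull (n + 1) k → GrothT n k) :=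
  fun _ _ h => le_antisymm (le_of_phiObj_hom (eqToHom h)) (le_of_phiObj_hom (eqToHom h.symm))

/-- The isomorphism `K_{n+1}(k) → K̂_1(k)ᵒᵖ ∫ T_k`. -/
noncomputable def phiFunctor (n k : ℕ) : KFull (n + 1) k ⥤ GrothT n k where
  obj := phiObj
  map u := GrothT.homMk (phiOne_le (leOfHom u)) (TMap_phiObj_le (leOfHom u))
  map_id _ := GrothT.hom_subsingleton _ _
  map_comp _ _ := GrothT.hom_subsingleton _ _

/-- The inverse of `phiFunctor`. -/
noncomputable def psiFunctor (n k : ℕ) : GrothT n k ⥤ KFull (n + 1) k where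
  obj X := (phiObj_surjective X).choose
  map {X Y} u := homOfLE (le_of_phiObj_hom (eqToHom (phiObj_surjective X).choose_spec ≫ u ≫
    eqToHom (phiObj_surjective Y).choose_spec.symm))

end Iso

theorem lemma4 (n k : ℕ) :
    -- the tensor product of `Ass` and `C_n` exists
    (∃ (P : TopOperad) (i : TopOperad.Hom assOperad P) (j : TopOperad.Hom (cubesOperad n) P),
      TopOperad.IsTensorProduct i j) ∧
    -- for every tensor product `P`, the space `P(k)` is a colimit of `A` and a colimit of `F_k`
    (∀ (P : TopOperad) (i : TopOperad.Hom assOperad P) (j : TopOperad.Hom (cubesOperad n) P),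
      TopOperad.IsTensorProduct i j →
      (∃ ι : ADiagram n k ⟶ (Functor.const _).obj (TopCat.of (P.Op (Fin k))),
        (∀ (l : (KHat 1 k)ᵒᵖ) (c : ASet n l.unop) (t : TotalOrd (Fin k)),
          (∀ a b h, l.unop.1.edge a b = some h → t.lt a b) →
          (ι.app l).hom c = orderedProduct i j t c.1) ∧
        Nonempty (Limits.IsColimit (Limits.Cocone.mk _ ι))) ∧
      (∃ ι : FDiagram n k ⟶ (Functor.const _).obj (TopCat.of (P.Op (Fin k))),
        (∀ (X : GrothT n k) (c : FSet X.fst X.snd) (t : TotalOrd (Fin k)),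
          (∀ a b h, X.fst.1.edge a b = some h → t.lt a b) →
          (ι.app X).hom c = orderedProduct i j t c.1) ∧
        Nonempty (Limits.IsColimit (Limits.Cocone.mk _ ι)))) ∧
    -- the spaces `H(m)` and the values of `F_k` are closed subspaces of `C_n(1)^k`
    (∀ m : KHat n k, IsClosed (HSet m)) ∧
    (∀ X : GrothT n k, IsClosed (FSet X.fst X.snd)) ∧
    -- `A(l)` is the colimit of `F_k(l)`, and the colimits over the subposets of all elements
    -- smaller than a given one are subspaces of `A(l)`
    (∀ l : KHat 1 k,
      ∃ ι : FFiber n l ⟶ (Functor.const _).obj (TopCat.of (ASet n l)),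
        (∀ (m : TPoset n k l) (c : FSet l m), ((ι.app m).hom c).1 = c.1) ∧
        Nonempty (Limits.IsColimit (Limits.Cocone.mk _ ι)) ∧
        ∀ (m : TPoset n k l) (s : Limits.Cocone (belowIncl m ⋙ FFiber n l))
          (hs : Limits.IsColimit s),
          Topology.IsEmbedding
            (hs.desc (Limits.Cocone.whisker (belowIncl m) (Limits.Cocone.mk _ ι))).hom) ∧
    -- the indexing category is isomorphic to `K_{n+1}(k)`
    (∃ (φ : KFull (n + 1) k ⥤ GrothT n k) (ψ : GrothT n k ⥤ KFull (n + 1) k),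
      φ ⋙ ψ = 𝟭 _ ∧ ψ ⋙ φ = 𝟭 _ ∧
      ∀ g, (φ.obj g).fst = phiOne g ∧ (φ.obj g).snd.1 = phiTwo g) := by
  refine ⟨⟨_, _, _, tensorOperad.isTensorProduct n⟩, fun P i j hP => ⟨⟨aCocone hP k,
    fun l c t ht => aCocone_app hP l c ht, aCocone_isColimit hP k⟩, ⟨fCocone hP k,
    fun X c t ht => fCocone_app hP X c ht, fCocone_isColimit hP k⟩⟩, isClosed_HSet,
    fun X => isClosed_FSet X.fst X.snd, fun l => ⟨fiberCocone n l, fun _ _ => rfl,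
    fiberCocone_isColimit l, fun m s hs => isEmbedding_desc_below l m s hs⟩,
    phiFunctor n k, psiFunctor n k, ?_, ?_, fun g => ⟨rfl, rfl⟩⟩
  · exact CategoryTheory.Functor.ext (fun g => phiObj_injective (phiObj_surjective (phiObj g)).choose_spec)
      fun _ _ _ => Subsingleton.elim _ _
  · exact CategoryTheory.Functor.ext (fun X => (phiObj_surjective X).choose_spec)
      fun _ _ _ => GrothT.hom_subsingleton _ _
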